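/- Let $I\subseteq\mathbb R$ be an open interval and $f:I\to\mathbb R$ a smooth function with $f\not\equiv 0$, and consider the generalized Krichever--Novikov (gKN) equation $$u_t = u_{xxx} - \frac{3}{2}\frac{u_{xx}^2}{u_x} + \frac{f(u)}{u_x}$$ for $u(t,x)$. Let $U$ be a non-empty connected open subset of the space with coordinates $(t,x,u,u_t,u_x,u_{tx},u_{xx},u_{tt},u_{txx})$ on which $u_x\neq 0$ and whose projection to the $u$-axis is $I$. A smooth function $\tilde P(t,x,u,u_t,u_x,u_{tx},u_{xx},u_{tt},u_{txx})$ on $U$ is called a symmetry characteristic of the gKN equation if $$D_t \tilde P-D_x^3 \tilde P +3 \frac{u_{xx}}{u_x}D_x^2 \tilde P-\frac{3}{2}\frac{u_{xx}^2}{u_x^2} D_x \tilde P +\frac{f(u)}{u_x^2} D_x \tilde P -\frac{f'(u)}{u_x} \tilde P=0$$ holds on solutions, i.e. at every point of the jet space lying over $U$ at which the gKN equation and all its differential consequences hold ($D_t$, $D_x$ are the total derivatives). It is called of higher order if its differential order is at least two, i.e. if it depends essentially on at least one of $u_{tx},u_{xx},u_{tt},u_{txx}$; it is the characteristic of a point symmetry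 if it has the form $\eta(t,x,u)-\tau(t,x,u)u_t-\xi(t,x,u)u_x$ with smooth $\eta,\tau,\xi$. Then the gKN equation admits a higher-order symmetry characteristic on $U$ if and only if $f$ is a polynomial of degree at most four, $$f(u)=C_1u^4+C_2u^3+C_3u^2+C_4u+C_5 .$$ In this case $$\tilde P_0 = u_{txx} -2\frac{u_{tx}u_{xx}}{u_x} +\frac{1}{2}\frac{u_{t}u_{xx}^2}{u_x^2} +\frac{1}{2}\frac{u_t^2}{u_x} -\frac{4}{3}\frac{u_{xx}^2 f(u)}{u_x^3} +\frac{4}{3}\frac{u_{xx} f'(u)}{u_x} -\frac{5}{3}\frac{u_t f(u)}{u_x^2} +\frac{8}{9}\frac{f(u)^2}{u_x^3} -\frac{4}{9} u_x f''(u)$$ is a higher-order symmetry characteristic, and it is the only one up to non-zero constant multiples and addition of point symmetries: the higher-order symmetry characteristics on $U$ are exactly the functions $c\,\tilde P_0+R$ with a constant $c\neq 0$ and $R$ the characteristic of a point symmetry of the gKN equation. -/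

import Mathlib

open scoped ContDiff

noncomputable section

namespace GKN

/-- The infinite jet space of functions `u(t,x)`: a point consists of the values of `t`, of `x`,
and of all derivatives of `u`, regarded as independent coordinates. -/
abbrev Jet : Type := ℝ × ℝ × (ℕ → ℕ → ℝ)

/-- The coordinate `u_{t…tx…x}` with `i` derivatives in `t` and `j` derivatives in `x`. -/
def u (i j : ℕ) (q : Jet) : ℝ := q.2.2 i j

/-- Total derivative with respect to `t`: the derivative of `F` along the vector field
`∂_t + ∑ u_{i+1,j} ∂/∂u_{i,j}` of the jet space. -/
def Dt (F : Jet → ℝ) (q : Jet) : ℝ :=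
  lineDeriv ℝ F q ((1, 0, fun i j => u (i + 1) j q) : Jet)

/-- Total derivative with respect to `x`: the derivative of `F` along the vector field
`∂_x + ∑ u_{i,j+1} ∂/∂u_{i,j}` of the jet space. -/
def Dx (F : Jet → ℝ) (q : Jet) : ℝ :=
  lineDeriv ℝ F q ((0, 1, fun i j => u i (j + 1) q) : Jet)

/-- The differential function `u_t - u_xxx + (3/2) u_xx² / u_x - f(u) / u_x`. -/
def gKN (f : ℝ → ℝ) (q : Jet) : ℝ :=
  u 1 0 q - u 0 3 q + 3 / 2 * (u 0 2 q ^ 2 / u 0 1 q) - f (u 0 0 q) / u 0 1 q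

/-- The points of the jet space (with `u_x ≠ 0`) at which the gKN equation and all of its
differential consequences hold, i.e. the jets of formal solutions. -/
def OnSolutions (f : ℝ → ℝ) (q : Jet) : Prop :=
  u 0 1 q ≠ 0 ∧ ∀ i j : ℕ, (Dt^[i] (Dx^[j] (gKN f))) q = 0

/-- The prolongation of `P ∂_u` applied to the gKN equation (left side of the determining
equation of symmetries). -/
def symmDet (f : ℝ → ℝ) (P : Jet → ℝ) (q : Jet) : ℝ :=
  Dt P q - (Dx^[3] P) q + 3 * (u 0 2 q / u 0 1 q) * (Dx^[2] P) q
    - 3 / 2 * (u 0 2 q ^ 2 / u 0 1 q ^ 2) * Dx P q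
    + f (u 0 0 q) / u 0 1 q ^ 2 * Dx P q
    - deriv f (u 0 0 q) / u 0 1 q * P q

/-- The nine variables `(t, x, u, u_t, u_x, u_tx, u_xx, u_tt, u_txx)`, in this order. -/
def mixed (q : Jet) : Fin 9 → ℝ :=
  ![q.1, q.2.1, u 0 0 q, u 1 0 q, u 0 1 q, u 1 1 q, u 0 2 q, u 2 0 q, u 1 2 q]

/-- `P(t, x, u, u_t, u_x, u_tx, u_xx, u_tt, u_txx)`, smooth on the open set `U`, is a symmetry
characteristic of the gKN equation: the determining equation holds on solutions. -/
def IsSymmChar (f : ℝ → ℝ) (U : Set (Fin 9 → ℝ)) (P : (Fin 9 → ℝ) → ℝ) : Prop :=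
  ContDiffOn ℝ ∞ P U ∧
    ∀ q : Jet, mixed q ∈ U → OnSolutions f q → symmDet f (fun q' => P (mixed q')) q = 0

/-- `P` essentially depends on at least one of `u_tx, u_xx, u_tt, u_txx`, that is, `P` has
differential order at least two. -/
def HasOrderAtLeastTwo (U : Set (Fin 9 → ℝ)) (P : (Fin 9 → ℝ) → ℝ) : Prop :=
  ∃ z ∈ U, ∃ i : Fin 9, 5 ≤ i ∧ fderiv ℝ P z (Pi.single i 1) ≠ 0

/-- A higher-order symmetry characteristic. -/
def IsHigherOrderSymmChar (f : ℝ → ℝ) (U : Set (Fin 9 → ℝ)) (P : (Fin 9 → ℝ) → ℝ) : Prop :=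
  IsSymmChar f U P ∧ HasOrderAtLeastTwo U P

/-- The variables `(t, x, u)`. -/
def txu (z : Fin 9 → ℝ) : ℝ × ℝ × ℝ := (z 0, z 1, z 2)

/-- The characteristic of a point symmetry:
`P = η(t,x,u) - τ(t,x,u) u_t - ξ(t,x,u) u_x` with smooth `η, τ, ξ`. -/
def IsPointSymmChar (f : ℝ → ℝ) (U : Set (Fin 9 → ℝ)) (P : (Fin 9 → ℝ) → ℝ) : Prop :=
  IsSymmChar f U P ∧
    ∃ η τ ξ : ℝ × ℝ × ℝ → ℝ,
      ContDiffOn ℝ ∞ η (txu '' U) ∧ ContDiffOn ℝ ∞ τ (txu '' U) ∧ ContDiffOn ℝ ∞ ξ (txu '' U) ∧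
      ∀ z ∈ U, P z = η (txu z) - τ (txu z) * z 3 - ξ (txu z) * z 4

/-- The restriction of `f` to `I` is a polynomial of degree at most four. -/
def IsQuarticOn (f : ℝ → ℝ) (I : Set ℝ) : Prop :=
  ∃ C₁ C₂ C₃ C₄ C₅ : ℝ, ∀ y ∈ I, f y = C₁ * y ^ 4 + C₂ * y ^ 3 + C₃ * y ^ 2 + C₄ * y + C₅

/-- The explicit higher-order characteristic. -/
def knChar (f : ℝ → ℝ) (z : Fin 9 → ℝ) : ℝ :=
  let f₀ := f (z 2)
  let f₁ := deriv f (z 2)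
  let f₂ := deriv (deriv f) (z 2)
  let ut := z 3
  let ux := z 4
  let utx := z 5
  let uxx := z 6
  let utxx := z 8
  utxx - 2 * (utx * uxx / ux) + 1 / 2 * (ut * uxx ^ 2 / ux ^ 2) + 1 / 2 * (ut ^ 2 / ux)
    - 4 / 3 * (uxx ^ 2 * f₀ / ux ^ 3) + 4 / 3 * (uxx * f₁ / ux)
    - 5 / 3 * (ut * f₀ / ux ^ 2) + 8 / 9 * (f₀ ^ 2 / ux ^ 3) - 4 / 9 * (ux * f₂)

end GKN

end

/-! A solution jet is determined by `t, x, u, p = u_x, η = u_xx/(2u_x)` and `ωₖ =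
D_x^k(u_t/(2u_x))`: with `χ = f/(2u_x²)` the equation is the Riccati relation `D_x η = ω₀ - χ + η²`,
and commutation of `D_t` and `D_x` gives the KdV-like flow `D_t ω₀ = ω₃ + mω₁`, `m = 6ω₀ - 8χ`.
These coordinates are free on the solution manifold, so an identity on solutions can be
differentiated in each of them separately. Writing `P = u_x S` turns the determining equation into
`E S = T S - X³S - m X S = 0` (`determining_mul`), where `X, T` are the restricted total
derivatives.

Necessity and uniqueness. The nine variables of a characteristic are functions of `t, x, u, p, η,
ω₀, …, ω₃`, hence so is `S`. The operators `T` and `X³` act alike on the highest coordinates, so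
differentiating `E S = 0` in the high `ωₖ` leaves equations `X a = 0`, whose solutions depend on `t`
only (`Frame.tOnly`). Quadratic terms then remove `∂S/∂ω₃` and `∂S/∂ω₁`. What survives is `9S =
δ(t)σ + 3γ(t)ω₀ + …`, up to further `t, x`-dependence, with an explicit `σ` linear in `ω₂` and
satisfying `E σ = 4·(f⁽⁵⁾/2)·p³` (`Frame.E_sigma`). The remainder turns out to be `α/p + β`;
comparing powers of `p` gives `δ` constant, `δ f⁽⁵⁾ = 0`, `α` quadratic in `u`, and `β` affine in
`x` (`Frame.solution`, `Frame.solution_const`). On connected `U` the constants are real numbers.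
Since `2pσ = 9 P̃₀` on solutions, every characteristic is a multiple of `P̃₀` plus a function of
point-symmetry shape, and order at least two forces `δ ≠ 0`, hence `f⁽⁵⁾ = 0`.

Sufficiency. The same algebraic identities hold in the ring of jet functions modulo the differential
ideal of the equation, and evaluation at a solution jet kills that ideal. Thus the determining
expression of `P̃₀` equals `(4/9) f⁽⁵⁾ u_x⁴` on solutions (`symmDet_knChar`), which vanishes exactly
for quartic `f`. Linearity of the determining equation supplies the remaining implications.

Jet space is infinite dimensional, so the analysis is confined to the algebra `Cyl` of smooth
functions of finitely many coordinates; the calculations take place in an abstract `Frame` and are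
purely algebraic. -/

noncomputable section

namespace GKN

/-! ### Smooth functions of finitely many coordinates -/

variable {ι : Type} {O : Set (ι → ℝ)}

/-- `F` is a smooth function of finitely many of the coordinates. -/
def IsCyl (O : Set (ι → ℝ)) (F : O → ℝ) : Prop :=
  ∃ (α : Type) (_ : Fintype α) (c : α → ι) (g : (α → ℝ) → ℝ),
    ∀ v : O, ContDiffAt ℝ ∞ g (fun a => v.1 (c a)) ∧ F v = g (fun a => v.1 (c a))

/-- The coordinate lists of the finitely many inner functions are concatenated by a sigma type;
repeated coordinates do no harm because the selection map need not be injective. -/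
theorem IsCyl.comp {β : Type} [Fintype β] {G : β → O → ℝ} (hG : ∀ b, IsCyl O (G b))
    {H : (β → ℝ) → ℝ} (hH : ∀ v, ContDiffAt ℝ ∞ H (fun b => G b v)) :
    IsCyl O (fun v => H (fun b => G b v)) := by
  choose α inst c g h using hG
  refine ⟨Σ b, α b, inferInstance, fun a => c a.1 a.2,
    fun w => H (fun b => g b (fun a => w ⟨b, a⟩)), fun v => ⟨?_, ?_⟩⟩
  · have h1 := hH v
    simp only [(h _ v).2] at h1
    refine ContDiffAt.comp (fun a : Σ b, α b => v.1 (c a.1 a.2)) h1 ?_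
    refine contDiffAt_pi.2 fun b => ?_
    refine ContDiffAt.comp (fun a : Σ b, α b => v.1 (c a.1 a.2)) (h b v).1 ?_
    fun_prop
  · simp only [(h _ v).2]

theorem IsCyl.coord (i : ι) : IsCyl O (fun v => v.1 i) :=
  ⟨Unit, inferInstance, fun _ => i, fun w => w (), fun _ => ⟨by fun_prop, rfl⟩⟩

theorem IsCyl.comp₁ {G : O → ℝ} (hG : IsCyl O G) {H : ℝ → ℝ}
    (hH : ∀ v, ContDiffAt ℝ ∞ H (G v)) : IsCyl O (fun v => H (G v)) := by
  refine IsCyl.comp (β := Unit) (G := fun _ => G) (fun _ => hG) (H := fun w => H (w ())) fun v => ?_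
  exact ContDiffAt.comp (fun _ : Unit => G v) (hH v) (by fun_prop)

theorem IsCyl.comp₂ {G₁ G₂ : O → ℝ} (h₁ : IsCyl O G₁) (h₂ : IsCyl O G₂) {H : ℝ × ℝ → ℝ}
    (hH : ContDiff ℝ ∞ H) : IsCyl O (fun v => H (G₁ v, G₂ v)) := by
  refine IsCyl.comp (β := Bool) (G := fun b => bif b then G₁ else G₂)
    (fun b => by cases b <;> assumption) (H := fun w => H (w true, w false)) fun v => ?_
  fun_prop

/-- The algebra of smooth functions of finitely many coordinates on `O`. -/
def Cyl (O : Set (ι → ℝ)) : Subalgebra ℝ (O → ℝ) where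
  carrier := {F | IsCyl O F}
  mul_mem' h₁ h₂ := h₁.comp₂ h₂ (H := fun z => z.1 * z.2) (by fun_prop)
  add_mem' h₁ h₂ := h₁.comp₂ h₂ (H := fun z => z.1 + z.2) (by fun_prop)
  algebraMap_mem' r :=
    ⟨Empty, inferInstance, Empty.elim, fun _ => r, fun _ => ⟨contDiffAt_const, rfl⟩⟩

namespace Cyl

instance : CoeFun (Cyl O) (fun _ => O → ℝ) := ⟨Subtype.val⟩

@[ext] theorem ext {F G : Cyl O} (h : ∀ v, F v = G v) : F = G := Subtype.ext (funext h)

@[simp] theorem add_apply (F G : Cyl O) (v : O) : (F + G) v = F v + G v := rfl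
@[simp] theorem sub_apply (F G : Cyl O) (v : O) : (F - G) v = F v - G v := rfl
@[simp] theorem neg_apply (F : Cyl O) (v : O) : (-F) v = -F v := rfl
@[simp] theorem mul_apply (F G : Cyl O) (v : O) : (F * G) v = F v * G v := rfl
@[simp] theorem pow_apply (F : Cyl O) (n : ℕ) (v : O) : (F ^ n) v = F v ^ n := rfl
@[simp] theorem smul_apply (r : ℝ) (F : Cyl O) (v : O) : (r • F) v = r * F v := rfl
@[simp] theorem one_apply (v : O) : (1 : Cyl O) v = 1 := rfl
@[simp] theorem zero_apply (v : O) : (0 : Cyl O) v = 0 := rfl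
@[simp] theorem ofNat_apply (n : ℕ) [n.AtLeastTwo] (v : O) :
    (ofNat(n) : Cyl O) v = ofNat(n) := rfl

@[simp] theorem sum_apply {α : Type*} (s : Finset α) (F : α → Cyl O) (v : O) :
    (∑ a ∈ s, F a) v = ∑ a ∈ s, F a v := by
  classical
  induction s using Finset.induction_on with
  | empty => simp
  | insert a s ha ih => simp [Finset.sum_insert ha, ih]

/-- A coordinate as an element of the algebra. -/
def coord (O : Set (ι → ℝ)) (i : ι) : Cyl O := ⟨_, IsCyl.coord i⟩

@[simp] theorem coord_apply (i : ι) (v : O) : coord O i v = v.1 i := rfl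

/-- Substitution into a smooth function of several variables. -/
def subst {β : Type} [Fintype β] (H : (β → ℝ) → ℝ) (G : β → Cyl O)
    (hH : ∀ v, ContDiffAt ℝ ∞ H (fun b => G b v)) : Cyl O :=
  ⟨fun v => H (fun b => G b v), IsCyl.comp (fun b => (G b).2) hH⟩

@[simp] theorem subst_apply {β : Type} [Fintype β] (H : (β → ℝ) → ℝ) (G : β → Cyl O)
    (hH : ∀ v, ContDiffAt ℝ ∞ H (fun b => G b v)) (v : O) :
    subst H G hH v = H (fun b => G b v) := rfl

/-- Substitution into a smooth function of one variable. -/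
def subst₁ (H : ℝ → ℝ) (G : Cyl O) (hH : ∀ v, ContDiffAt ℝ ∞ H (G v)) : Cyl O :=
  ⟨fun v => H (G v), IsCyl.comp₁ G.2 hH⟩

@[simp] theorem subst₁_apply (H : ℝ → ℝ) (G : Cyl O) (hH : ∀ v, ContDiffAt ℝ ∞ H (G v)) (v : O) :
    subst₁ H G hH v = H (G v) := rfl

open Classical in
/-- Extension by zero. -/
def ext0 (F : O → ℝ) (v : ι → ℝ) : ℝ := if h : v ∈ O then F ⟨v, h⟩ else 0

theorem ext0_apply (F : O → ℝ) (v : O) : ext0 F v = F v := by simp [ext0]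

theorem line_mem (hO : IsOpen O) {v : ι → ℝ} (hv : v ∈ O) (w : ι → ℝ) :
    ∀ᶠ s : ℝ in nhds 0, v + s • w ∈ O := by
  have : ContinuousAt (fun s : ℝ => v + s • w) 0 := by fun_prop
  exact this (hO.mem_nhds (by simpa using hv))

theorem hasLineDerivAt_rep (hO : IsOpen O) {F : O → ℝ} {α : Type} [Fintype α] {c : α → ι}
    {g : (α → ℝ) → ℝ}
    (h : ∀ v : O, ContDiffAt ℝ ∞ g (fun a => v.1 (c a)) ∧ F v = g (fun a => v.1 (c a)))
    (v : O) (w : ι → ℝ) :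
    HasLineDerivAt ℝ (ext0 F) (fderiv ℝ g (fun a => v.1 (c a)) (fun a => w (c a))) v.1 w := by
  have h1 : HasFDerivAt g (fderiv ℝ g (fun a => v.1 (c a))) (fun a => v.1 (c a)) :=
    ((h v).1.differentiableAt (by simp)).hasFDerivAt
  have h2 := h1.hasLineDerivAt (fun a => w (c a))
  refine HasDerivAt.congr_of_eventuallyEq h2 ?_
  filter_upwards [line_mem hO v.2 w] with s hs
  have := (h ⟨_, hs⟩).2
  simp only [ext0, hs, dif_pos, this]
  rfl

theorem lineDifferentiableAt (hO : IsOpen O) (F : Cyl O) (v : O) (w : ι → ℝ) :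
    LineDifferentiableAt ℝ (ext0 F) v.1 w := by
  obtain ⟨α, _, c, g, h⟩ := F.2
  exact (hasLineDerivAt_rep hO h v w).lineDifferentiableAt

/-- The derivative of `F` along the vector field with components `ξ`, as a function. -/
def dirFun (ξ : ι → Cyl O) (F : O → ℝ) (v : O) : ℝ :=
  lineDeriv ℝ (ext0 F) v.1 (fun i => ξ i v)

theorem fderiv_pi_apply {α : Type} [Fintype α] (L : (α → ℝ) →L[ℝ] ℝ) (w : α → ℝ) [DecidableEq α] :
    L w = ∑ a, w a * L (Pi.single a 1) := by
  conv_lhs => rw [pi_eq_sum_univ' w]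
  simp

/-- Derivatives along all vector fields come from one gradient with symmetric Hessian. -/
theorem exists_gradient (hO : IsOpen O) (F : Cyl O) :
    ∃ (α : Type) (_ : Fintype α) (c : α → ι) (G : α → Cyl O) (H : α → α → Cyl O),
      (∀ ξ v, dirFun ξ F v = ∑ a, ξ (c a) v * G a v) ∧
      (∀ a ξ v, dirFun ξ (G a) v = ∑ b, ξ (c b) v * H a b v) ∧ ∀ a b, H a b = H b a := by
  classical
  obtain ⟨α, _, c, g, h⟩ := F.2
  have hs : ∀ (k : (α → ℝ) → ℝ) (a : α) (x : α → ℝ), ContDiffAt ℝ ∞ k x →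
      ContDiffAt ℝ ∞ (fun w => fderiv ℝ k w (Pi.single a 1)) x := fun k a x hk =>
    (hk.fderiv_right (m := ∞) (by simp)).clm_apply contDiffAt_const
  let g1 : α → (α → ℝ) → ℝ := fun a w => fderiv ℝ g w (Pi.single a 1)
  let g2 : α → α → (α → ℝ) → ℝ := fun a b w => fderiv ℝ (g1 a) w (Pi.single b 1)
  have hg1 : ∀ a (v : O), ContDiffAt ℝ ∞ (g1 a) (fun a => v.1 (c a)) := fun a v => hs _ _ _ (h v).1
  have hg2 : ∀ a b (v : O), ContDiffAt ℝ ∞ (g2 a b) (fun a => v.1 (c a)) :=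
    fun a b v => hs _ _ _ (hg1 a v)
  refine ⟨α, inferInstance, c, fun a => ⟨fun v => g1 a (fun a => v.1 (c a)), α, inferInstance, c,
    g1 a, fun v => ⟨hg1 a v, rfl⟩⟩, fun a b => ⟨fun v => g2 a b (fun a => v.1 (c a)), α,
    inferInstance, c, g2 a b, fun v => ⟨hg2 a b v, rfl⟩⟩, ?_, ?_, ?_⟩
  · intro ξ v
    rw [dirFun, (hasLineDerivAt_rep hO h v _).lineDeriv, fderiv_pi_apply]
  · intro a ξ v
    rw [dirFun, (hasLineDerivAt_rep hO (g := g1 a) (c := c)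
      (fun v => ⟨hg1 a v, rfl⟩) v _).lineDeriv, fderiv_pi_apply]
  · intro a b
    ext v
    have hsym : IsSymmSndFDerivAt ℝ g (fun a => v.1 (c a)) :=
      (h v).1.isSymmSndFDerivAt (by simpa using (by exact_mod_cast le_top : ((2 : ℕ∞) : WithTop ℕ∞) ≤ ∞))
    have hd : DifferentiableAt ℝ (fderiv ℝ g) (fun a => v.1 (c a)) :=
      ((h v).1.fderiv_right (m := ∞) (by simp)).differentiableAt (by simp)
    have hcalc : ∀ a b, g2 a b (fun a => v.1 (c a)) =
        fderiv ℝ (fderiv ℝ g) (fun a => v.1 (c a)) (Pi.single b 1) (Pi.single a 1) := by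
      intro a b
      simp only [g2, g1]
      rw [fderiv_clm_apply hd (by fun_prop)]
      simp
    change g2 a b _ = g2 b a _
    rw [hcalc, hcalc, hsym.eq]

/-- The derivation along the vector field with components `ξ`. -/
def D (hO : IsOpen O) (ξ : ι → Cyl O) : Derivation ℝ (Cyl O) (Cyl O) :=
  Derivation.mk'
    { toFun := fun F => ⟨dirFun ξ F, by
        obtain ⟨α, _, c, G, _, h, -⟩ := exists_gradient hO F
        have : dirFun ξ F = (∑ a, ξ (c a) * G a : Cyl O) := by
          funext v; rw [h]; simp
        rw [this]; exact Subtype.property _⟩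
      map_add' := fun F G => by
        ext v
        have h := (lineDifferentiableAt hO F v (fun i => ξ i v)).hasLineDerivAt.add
          (lineDifferentiableAt hO G v (fun i => ξ i v)).hasLineDerivAt
        refine Eq.trans ?_ h.deriv
        change lineDeriv _ _ _ _ = _
        unfold lineDeriv
        congr 1
        funext w
        by_cases hw : v.1 + w • (fun i => ξ i v) ∈ O <;> simp [ext0, hw]
      map_smul' := fun r F => by
        ext v
        have h := (lineDifferentiableAt hO F v (fun i => ξ i v)).hasLineDerivAt.const_smul r
        refine Eq.trans ?_ h.deriv
        change lineDeriv _ _ _ _ = _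
        unfold lineDeriv
        congr 1
        funext w
        by_cases hw : v.1 + w • (fun i => ξ i v) ∈ O <;> simp [ext0, hw] }
    fun F G => by
      ext v
      have h := HasDerivAt.mul (lineDifferentiableAt hO F v (fun i => ξ i v)).hasLineDerivAt
        (lineDifferentiableAt hO G v (fun i => ξ i v)).hasLineDerivAt
      have h' := h.deriv
      simp only [zero_smul, add_zero, ext0_apply] at h'
      have : dirFun ξ (F * G : Cyl O) v = dirFun ξ F v * G v + F v * dirFun ξ G v := by
        refine Eq.trans ?_ h'
        change lineDeriv _ _ _ _ = _
        unfold lineDeriv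
        congr 1
        funext w
        by_cases hw : v.1 + w • (fun i => ξ i v) ∈ O <;> simp [ext0, hw]
      change dirFun ξ (F * G : Cyl O) v = F v * dirFun ξ G v + G v * dirFun ξ F v
      rw [this]; ring

theorem D_apply (hO : IsOpen O) (ξ : ι → Cyl O) (F : Cyl O) (v : O) :
    D hO ξ F v = lineDeriv ℝ (ext0 F) v.1 (fun i => ξ i v) := rfl

theorem exists_gradient' (hO : IsOpen O) (F : Cyl O) :
    ∃ (α : Type) (_ : Fintype α) (c : α → ι) (G : α → Cyl O) (H : α → α → Cyl O),
      (∀ ξ, D hO ξ F = ∑ a, ξ (c a) * G a) ∧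
      (∀ a ξ, D hO ξ (G a) = ∑ b, ξ (c b) * H a b) ∧ ∀ a b, H a b = H b a := by
  obtain ⟨α, i, c, G, H, h1, h2, h3⟩ := exists_gradient hO F
  refine ⟨α, i, c, G, H, fun ξ => ?_, fun a ξ => ?_, h3⟩
  · ext v; refine (h1 ξ v).trans ?_; simp
  · ext v; refine (h2 a ξ v).trans ?_; simp

theorem D_coord (hO : IsOpen O) (ξ : ι → Cyl O) (i : ι) : D hO ξ (coord O i) = ξ i := by
  ext v
  have h := hasLineDerivAt_rep hO (F := coord O i) (α := Unit) (c := fun _ => i)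
    (g := fun w => w ()) (fun _ => ⟨by fun_prop, rfl⟩) v (fun i => ξ i v)
  have e : fderiv ℝ (fun w : Unit → ℝ => w ()) (fun _ => v.1 i) = ContinuousLinearMap.proj () :=
    (ContinuousLinearMap.proj (R := ℝ) (φ := fun _ : Unit => ℝ) ()).fderiv
  rw [D_apply, h.lineDeriv, e]
  rfl

theorem D_subst (hO : IsOpen O) (ξ : ι → Cyl O) {β : Type} [Fintype β] [DecidableEq β]
    (H : (β → ℝ) → ℝ) (G : β → Cyl O)
    (hH : ∀ v, ContDiffAt ℝ ∞ H (fun b => G b v)) (v : O) :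
    D hO ξ (subst H G hH) v =
      ∑ b, D hO ξ (G b) v * fderiv ℝ H (fun b => G b v) (Pi.single b 1) := by
  have h1 : HasFDerivAt H (fderiv ℝ H (fun b => G b v)) (fun b => G b v) :=
    ((hH v).differentiableAt (by simp)).hasFDerivAt
  have h2 : HasDerivAt (fun s : ℝ => fun b => ext0 (G b) (v.1 + s • (fun i => ξ i v)))
      (fun b => D hO ξ (G b) v) 0 := by
    refine hasDerivAt_pi.2 fun b => ?_
    exact (lineDifferentiableAt hO (G b) v (fun i => ξ i v)).hasLineDerivAt
  have h3 : HasDerivAt (fun s : ℝ => ext0 (subst H G hH) (v.1 + s • (fun i => ξ i v)))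
      (fderiv ℝ H (fun b => G b v) (fun b => D hO ξ (G b) v)) 0 := by
    have h1' : HasFDerivAt H (fderiv ℝ H (fun b => G b v))
        (fun b => ext0 (G b) (v.1 + (0 : ℝ) • (fun i => ξ i v))) := by
      simpa [ext0_apply] using h1
    refine (h1'.comp_hasDerivAt 0 h2).congr_of_eventuallyEq ?_
    filter_upwards [line_mem hO v.2 (fun i => ξ i v)] with s hs
    simp [ext0, hs]
  rw [D_apply]
  refine h3.deriv.trans ?_
  rw [fderiv_pi_apply]

theorem D_subst₁ (hO : IsOpen O) (ξ : ι → Cyl O) (H : ℝ → ℝ) (G : Cyl O)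
    (hH : ∀ v, ContDiffAt ℝ ∞ H (G v)) (v : O) :
    D hO ξ (subst₁ H G hH) v = deriv H (G v) * D hO ξ G v := by
  have h1 : HasDerivAt H (deriv H (ext0 G (v.1 + (0 : ℝ) • (fun i => ξ i v))))
      (ext0 G (v.1 + (0 : ℝ) • (fun i => ξ i v))) := by
    simpa [ext0_apply] using ((hH v).differentiableAt (by simp)).hasDerivAt
  have h2 := (lineDifferentiableAt hO G v (fun i => ξ i v)).hasLineDerivAt
  have h3 := h1.comp (0 : ℝ) h2
  have h4 : HasDerivAt (fun s : ℝ => ext0 (subst₁ H G hH) (v.1 + s • (fun i => ξ i v)))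
      (deriv H (G v) * D hO ξ G v) 0 := by
    rw [D_apply]
    simp only [zero_smul, add_zero, ext0_apply] at h3
    refine h3.congr_of_eventuallyEq ?_
    filter_upwards [line_mem hO v.2 (fun i => ξ i v)] with s hs
    simp [ext0, hs]
  exact h4.deriv

/-- The second-order terms of the two compositions agree by symmetry of the Hessian, so only the Lie
bracket `ζ` of the vector fields remains. It is enough to know the bracket on coordinates. -/
theorem D_comm (hO : IsOpen O) (ξ η ζ : ι → Cyl O)
    (h : ∀ i, ζ i = D hO ξ (η i) - D hO η (ξ i)) (F : Cyl O) :
    D hO ξ (D hO η F) = D hO η (D hO ξ F) + D hO ζ F := by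
  obtain ⟨α, _, c, G, H, h1, h2, h3⟩ := exists_gradient' hO F
  simp only [h1, map_sum, Derivation.leibniz, smul_eq_mul, h2, h, Finset.sum_add_distrib, sub_mul,
    Finset.sum_sub_distrib, Finset.mul_sum]
  have : ∑ a, ∑ b, η (c a) * (ξ (c b) * H a b) = ∑ a, ∑ b, ξ (c a) * (η (c b) * H a b) := by
    rw [Finset.sum_comm]
    refine Finset.sum_congr rfl fun a _ => Finset.sum_congr rfl fun b _ => ?_
    rw [h3]; ring
  rw [this]
  simp only [mul_comm (G _)]
  ring

/-- The partial derivative in the `i`-th coordinate. -/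
def pd [DecidableEq ι] (hO : IsOpen O) (i : ι) : Derivation ℝ (Cyl O) (Cyl O) := D hO (Pi.single i 1)

theorem D_eq_sum [DecidableEq ι] (hO : IsOpen O) (ξ : ι → Cyl O) (F : Cyl O) (s : Finset ι)
    (hs : ∀ i ∉ s, ξ i * pd hO i F = 0) : D hO ξ F = ∑ i ∈ s, ξ i * pd hO i F := by
  obtain ⟨α, _, c, G, H, h1, -, -⟩ := exists_gradient' hO F
  -- A coordinate may be listed several times in `c`; its partial derivative collects the whole
  -- fibre.
  have hp : ∀ i, pd hO i F = ∑ a with c a = i, G a := by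
    intro i
    rw [pd, h1, Finset.sum_filter]
    refine Finset.sum_congr rfl fun a _ => ?_
    by_cases hi : c a = i <;> simp [hi]
  have key : D hO ξ F = ∑ i ∈ s ∪ Finset.univ.image c, ξ i * pd hO i F := by
    rw [h1, ← Finset.sum_fiberwise_of_maps_to (s := Finset.univ) (g := c)
      (t := s ∪ Finset.univ.image c) (fun a _ => by simp)]
    refine Finset.sum_congr rfl fun i _ => ?_
    rw [hp, Finset.mul_sum]
    refine Finset.sum_congr rfl fun a ha => ?_
    rw [(Finset.mem_filter.1 ha).2]
  rw [key]
  symm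
  exact Finset.sum_subset Finset.subset_union_left fun i _ hi => hs i hi

theorem pd_comm [DecidableEq ι] (hO : IsOpen O) (i j : ι) (F : Cyl O) :
    pd hO i (pd hO j F) = pd hO j (pd hO i F) := by
  have hz : ∀ i j k : ι, D hO (Pi.single i 1) ((Pi.single j 1 : ι → Cyl O) k) = 0 := by
    intro i j k
    by_cases h : k = j
    · subst h; simp
    · simp [h]
  have := D_comm hO (Pi.single i 1) (Pi.single j 1) 0 (fun k => by simp [hz]) F
  have h0 : D hO (0 : ι → Cyl O) F = 0 := by
    obtain ⟨α, _, c, G, H, h1, -, -⟩ := exists_gradient' hO F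
    simp [h1]
  rw [h0, add_zero] at this
  exact this

theorem pd_D [DecidableEq ι] (hO : IsOpen O) (i : ι) (ξ : ι → Cyl O) (F : Cyl O) :
    pd hO i (D hO ξ F) = D hO ξ (pd hO i F) + D hO (fun j => pd hO i (ξ j)) F := by
  refine D_comm hO _ _ _ (fun k => ?_) F
  by_cases h : k = i
  · subst h; simp [pd]
  · simp [pd, h]

theorem pd_coord [DecidableEq ι] (hO : IsOpen O) (i j : ι) :
    pd hO i (coord O j) = if i = j then 1 else 0 := by
  rw [pd, D_coord, Pi.single_apply]
  simp [eq_comm]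

/-- Functions with vanishing partial derivatives are constant on a connected set. -/
theorem exists_eq_const [DecidableEq ι] (hO : IsOpen O) (hc : IsPreconnected O) (F : Cyl O)
    (hF : ∀ i, pd hO i F = 0) : ∃ r : ℝ, ∀ v, F v = r := by
  have hD : ∀ ξ, D hO ξ F = 0 := fun ξ => by
    rw [D_eq_sum hO ξ F ∅ (fun i _ => by rw [hF i, mul_zero])]; simp
  have hline : ∀ v : O, ∀ w : ι → ℝ, HasDerivAt (fun s : ℝ => ext0 F (v.1 + s • w)) 0 0 := by
    intro v w
    have h := (lineDifferentiableAt hO F v w).hasLineDerivAt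
    have h2 := congrArg (fun G : Cyl O => G v) (hD (fun i => algebraMap ℝ _ (w i)))
    have h3 : lineDeriv ℝ (ext0 F) v.1 w = 0 := h2
    rw [h3] at h
    exact h
  -- The product topology is locally convex, so nearby points are joined by a segment inside `O`,
  -- along which the derivative vanishes.
  have hloc : IsLocallyConstant F.1 := by
    rw [IsLocallyConstant.iff_eventually_eq]
    intro v
    obtain ⟨N, ⟨hN, hNc⟩, hNO⟩ := (LocallyConvexSpace.convex_basis (𝕜 := ℝ) v.1).mem_iff.1
      (hO.mem_nhds v.2)
    have : ∀ᶠ w : O in nhds v, w.1 ∈ N := continuous_subtype_val.continuousAt hN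
    filter_upwards [this] with w hw
    let φ : ℝ → ℝ := fun s => ext0 F (v.1 + s • (w.1 - v.1))
    have hφ : ∀ s ∈ Set.Icc (0 : ℝ) 1, HasDerivAt φ 0 s := by
      intro s hs
      have hm : v.1 + s • (w.1 - v.1) ∈ N :=
        hNc.add_smul_sub_mem (mem_of_mem_nhds hN) hw hs
      have h := hline ⟨_, hNO hm⟩ (w.1 - v.1)
      have h' := HasDerivAt.comp (h₂ := fun r : ℝ => ext0 F (v.1 + s • (w.1 - v.1) + r • (w.1 - v.1)))
        (h := fun r => r - s) s (by simpa using h) ((hasDerivAt_id s).sub_const s)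
      have e : φ = (fun r : ℝ => ext0 F (v.1 + s • (w.1 - v.1) + r • (w.1 - v.1))) ∘
          fun r => r - s := by
        funext r
        simp only [φ, Function.comp, add_assoc, ← add_smul]
        congr 3; ring
      rw [e]
      simpa using h'
    have h01 := constant_of_derivWithin_zero (f := φ) (a := 0) (b := 1)
      (fun s hs => (hφ s hs).differentiableAt.differentiableWithinAt)
      (fun s hs => ((hφ s ⟨hs.1, hs.2.le⟩).hasDerivWithinAt.derivWithin
        (uniqueDiffOn_Icc zero_lt_one s ⟨hs.1, hs.2.le⟩))) 1 (by simp)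
    simp only [φ, one_smul, zero_smul, add_zero, add_sub_cancel, ext0_apply] at h01
    exact h01
  have : PreconnectedSpace O := Subtype.preconnectedSpace hc
  by_cases hne : Nonempty O
  · obtain ⟨v0⟩ := hne
    exact ⟨F v0, fun v => hloc.apply_eq_of_preconnectedSpace v v0⟩
  · exact ⟨0, fun v => (hne ⟨v⟩).elim⟩

/-! ### Pullback -/

variable {ι' : Type} {O' : Set (ι' → ℝ)}

/-- Pullback along a map with components in the algebra. -/
def pull (Ψ : ι' → Cyl O) (hΨ : ∀ v, (fun i => Ψ i v) ∈ O') (F : Cyl O') : Cyl O :=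
  ⟨fun v => F ⟨fun i => Ψ i v, hΨ v⟩, by
    obtain ⟨α, _, c, g, h⟩ := F.2
    have : (fun v => F ⟨fun i => Ψ i v, hΨ v⟩) = fun v => g (fun a => Ψ (c a) v) :=
      funext fun v => (h ⟨_, hΨ v⟩).2
    rw [this]
    exact IsCyl.comp (fun a => (Ψ (c a)).2) (fun v => (h ⟨_, hΨ v⟩).1)⟩

@[simp] theorem pull_apply (Ψ : ι' → Cyl O) (hΨ : ∀ v, (fun i => Ψ i v) ∈ O') (F : Cyl O') (v : O) :
    pull Ψ hΨ F v = F ⟨fun i => Ψ i v, hΨ v⟩ := rfl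

/-- The chain rule for `Ψ`-related vector fields; being related has to be tested on coordinates
only. -/
theorem D_pull (hO : IsOpen O) (hO' : IsOpen O') (Ψ : ι' → Cyl O)
    (hΨ : ∀ v, (fun i => Ψ i v) ∈ O') (ξ : ι → Cyl O) (η : ι' → Cyl O')
    (h : ∀ i, D hO ξ (Ψ i) = pull Ψ hΨ (η i)) (F : Cyl O') :
    D hO ξ (pull Ψ hΨ F) = pull Ψ hΨ (D hO' η F) := by
  classical
  obtain ⟨α, _, c, g, hg⟩ := F.2
  have e : pull Ψ hΨ F = subst g (fun a => Ψ (c a)) (fun v => (hg ⟨_, hΨ v⟩).1) :=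
    ext fun v => (hg ⟨_, hΨ v⟩).2
  ext v
  rw [e, D_subst, pull_apply, D_apply, (hasLineDerivAt_rep hO' hg _ _).lineDeriv, fderiv_pi_apply]
  refine Finset.sum_congr rfl fun a _ => ?_
  rw [h]
  rfl

end Cyl

/-! ### The abstract frame and the two key identities -/

/-- The algebraic frame of the equation: functions of `t, x, u, p, η, ω₀, ω₁, …` (the coordinates
`v 0, v 1, …`), where `p = u_x`, `2 η = u_xx / u_x`, `2 ωₖ = D_x^k (u_t / u_x)`, with the partial
derivatives `d i`, the total derivatives `X` and `T`, the inverse `q` of `p`, and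
`F k = f⁽ᵏ⁾(u) / 2`. -/
structure Frame (A : Type) [CommRing A] [Algebra ℝ A] where
  d : ℕ → Derivation ℝ A A
  X : Derivation ℝ A A
  T : Derivation ℝ A A
  v : ℕ → A
  q : A
  F : ℕ → A
  d_v : ∀ i j, d i (v j) = if i = j then 1 else 0
  d_comm : ∀ i j a, d i (d j a) = d j (d i a)
  q_mul : q * v 3 = 1
  d_F : ∀ i k, d i (F k) = if i = 2 then F (k + 1) else 0
  X_v0 : X (v 0) = 0
  X_v1 : X (v 1) = 1
  X_v2 : X (v 2) = v 3
  X_v3 : X (v 3) = 2 * v 3 * v 4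
  X_v4 : X (v 4) = v 5 - F 0 * q ^ 2 + v 4 ^ 2
  X_v5 : ∀ k, X (v (k + 5)) = v (k + 6)
  T_v0 : T (v 0) = 1
  T_v1 : T (v 1) = 0
  T_v2 : T (v 2) = 2 * v 3 * v 5
  T_v3 : T (v 3) = v 3 * (4 * v 4 * v 5 + 2 * v 6)
  T_v4 : T (v 4) = v 7 + 2 * (v 5 - F 0 * q ^ 2 + v 4 ^ 2) * v 5 + 2 * v 4 * v 6
  T_v5 : ∀ k, T (v (k + 5)) = X^[k] (v 8 + (6 * v 5 - 8 * (F 0 * q ^ 2)) * v 6)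
  X_eq : ∀ n a, (∀ i, n ≤ i → d i a = 0) → X a = ∑ i ∈ Finset.range n, X (v i) * d i a
  T_eq : ∀ n a, (∀ i, n ≤ i → d i a = 0) → T a = ∑ i ∈ Finset.range n, T (v i) * d i a
  d_X : ∀ i (s : Finset ℕ), (∀ j ∉ s, d i (X (v j)) = 0) →
    ∀ a, d i (X a) = X (d i a) + ∑ j ∈ s, d i (X (v j)) * d j a

theorem eq_zero_of_ofNat_mul {A : Type} [CommRing A] [Algebra ℝ A] (n : ℕ) [n.AtLeastTwo] {a : A}
    (h : (ofNat(n) : A) * a = 0) : a = 0 := by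
  have h1 : (ofNat(n) : ℝ) • a = 0 := by
    rw [Algebra.smul_def, map_ofNat]; exact h
  exact (smul_eq_zero.1 h1).resolve_left (by simp)

@[simp] theorem derivation_ofNat {A : Type} [CommRing A] [Algebra ℝ A] (D : Derivation ℝ A A)
    (n : ℕ) [n.AtLeastTwo] : D ofNat(n) = 0 := by
  rw [← Nat.cast_ofNat, D.map_natCast]

/-- The determining operator applied to the higher-order solution. -/
theorem determining_sigma {A : Type} [CommRing A] [Algebra ℝ A] (X T : Derivation ℝ A A)
    {p η w χ ψ F₂ F₃ F₄ F₅ : A} (hp : X p = 2 * p * η) (hη : X η = w - χ + η ^ 2)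
    (hχ : X χ = ψ - 4 * η * χ) (hψ : X ψ = F₂ - 2 * η * ψ) (h₂ : X F₂ = p * F₃)
    (h₃ : X F₃ = p * F₄) (h₄ : X F₄ = p * F₅)
    (tη : T η = X (X w) + 2 * (w - χ + η ^ 2) * w + 2 * η * X w)
    (tw : T w = X (X (X w)) + (6 * w - 8 * χ) * X w) (tw₂ : T (X (X w)) = X (X (T w)))
    (tχ : T χ = 2 * w * ψ - 2 * (4 * η * w + 2 * X w) * χ)
    (tψ : T ψ = 2 * w * F₂ - (4 * η * w + 2 * X w) * ψ) (t₂ : T F₂ = 2 * p * w * F₃) {σ : A}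
    (hσ : σ = 9 * X (X w) + 27 * w ^ 2 - 48 * χ * w - 48 * η ^ 2 * χ + 24 * η * ψ +
      16 * χ ^ 2 - 4 * F₂) :
    T σ - X (X (X σ)) - (6 * w - 8 * χ) * X σ = 4 * F₅ * p ^ 3 := by
  subst hσ
  simp [hp, hη, hχ, hψ, h₂, h₃, h₄, tη, tw, tw₂, tχ, tψ, t₂]
  ring

/-- The determining equation for `Q = p S` in terms of `S`. -/
theorem determining_mul {A : Type} [CommRing A] [Algebra ℝ A] (X T : Derivation ℝ A A)
    {p η w χ ψ : A} (hp : X p = 2 * p * η) (hη : X η = w - χ + η ^ 2)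
    (hχ : X χ = ψ - 4 * η * χ) (tp : T p = p * (4 * η * w + 2 * X w)) (S : A) :
    T (p * S) - X (X (X (p * S))) + 6 * η * X (X (p * S)) - 6 * η ^ 2 * X (p * S)
      + 2 * χ * X (p * S) - 2 * ψ * (p * S) =
      p * (T S - X (X (X S)) - (6 * w - 8 * χ) * X S) := by
  simp [hp, hη, hχ, tp]
  ring

/-! ### Structure equations and commutators in the frame -/

namespace Frame
set_option linter.unusedSimpArgs false

variable {A : Type} [CommRing A] [Algebra ℝ A] (K : Frame A)

theorem d_q (i : ℕ) : K.d i K.q = if i = 3 then -K.q ^ 2 else 0 := by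
  have h := congrArg (K.d i) K.q_mul
  simp only [Derivation.leibniz, K.d_v, smul_eq_mul, Derivation.map_one_eq_zero] at h
  split_ifs at h ⊢
  · linear_combination K.q * h - K.d i K.q * K.q_mul
  · linear_combination K.q * h - K.d i K.q * K.q_mul

theorem X_q : K.X K.q = - (2 * K.q * K.v 4) := by
  have h := congrArg K.X K.q_mul
  simp only [Derivation.leibniz, K.X_v3, smul_eq_mul, Derivation.map_one_eq_zero] at h
  linear_combination K.q * h - (K.X K.q + 2 * K.v 4 * K.q) * K.q_mul

theorem T_q : K.T K.q = - (K.q * (4 * K.v 4 * K.v 5 + 2 * K.v 6)) := by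
  have h := congrArg K.T K.q_mul
  simp only [Derivation.leibniz, K.T_v3, smul_eq_mul, Derivation.map_one_eq_zero] at h
  linear_combination K.q * h - (K.T K.q + (4 * K.v 4 * K.v 5 + 2 * K.v 6) * K.q) * K.q_mul

theorem X_F (k : ℕ) : K.X (K.F k) = K.v 3 * K.F (k + 1) := by
  rw [K.X_eq 3 _ (fun i hi => by rw [K.d_F, if_neg (by omega)])]
  simp [K.d_F, K.X_v2]

theorem T_F (k : ℕ) : K.T (K.F k) = 2 * K.v 3 * K.v 5 * K.F (k + 1) := by
  rw [K.T_eq 3 _ (fun i hi => by rw [K.d_F, if_neg (by omega)])]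
  simp [K.d_F, K.T_v2]

/-- The coordinate `ω_{k+1}` enters the coefficients of `X` only through `X ωₖ = ω_{k+1}`. This
commutator drives every descent in the order. -/
theorem d_X_succ (k : ℕ) (a : A) : K.d (k + 6) (K.X a) = K.X (K.d (k + 6) a) + K.d (k + 5) a := by
  rw [K.d_X (k + 6) {k + 5}]
  · simp [K.X_v5, K.d_v]
  · intro j hj
    simp only [Finset.mem_singleton] at hj
    match j with
    | 0 => simp [K.X_v0]
    | 1 => simp [K.X_v1]
    | 2 => simp [K.X_v2, K.d_v]
    | 3 => simp [K.X_v3, K.d_v]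
    | 4 => simp [K.X_v4, K.d_v, K.d_F, K.d_q]
    | j + 5 => rw [K.X_v5, K.d_v, if_neg (by omega)]

theorem d_X_low (i : ℕ) (hi : i < 6) (a : A) : K.d i (K.X a) = K.X (K.d i a) +
    ∑ j ∈ Finset.range 5, K.d i (K.X (K.v j)) * K.d j a := by
  refine K.d_X i _ (fun j hj => ?_) a
  obtain ⟨k, rfl⟩ : ∃ k, j = k + 5 := ⟨j - 5, by simp at hj; omega⟩
  rw [K.X_v5, K.d_v, if_neg (by omega)]

theorem d3_X (a : A) : K.d 3 (K.X a) = K.X (K.d 3 a) + K.d 2 a + 2 * K.v 4 * K.d 3 a +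
    2 * K.F 0 * K.q ^ 3 * K.d 4 a := by
  rw [K.d_X_low 3 (by omega)]
  simp [Finset.sum_range_succ, K.X_v0, K.X_v1, K.X_v2, K.X_v3, K.X_v4, K.d_v, K.d_F, K.d_q]
  ring

theorem d4_X (a : A) : K.d 4 (K.X a) = K.X (K.d 4 a) + 2 * K.v 3 * K.d 3 a +
    2 * K.v 4 * K.d 4 a := by
  rw [K.d_X_low 4 (by omega)]
  simp [Finset.sum_range_succ, K.X_v0, K.X_v1, K.X_v2, K.X_v3, K.X_v4, K.d_v, K.d_F, K.d_q]
  ring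

theorem d5_X (a : A) : K.d 5 (K.X a) = K.X (K.d 5 a) + K.d 4 a := by
  rw [K.d_X_low 5 (by omega)]
  simp [Finset.sum_range_succ, K.X_v0, K.X_v1, K.X_v2, K.X_v3, K.X_v4, K.d_v, K.d_F, K.d_q]

theorem d6_X (a : A) : K.d 6 (K.X a) = K.X (K.d 6 a) + K.d 5 a := K.d_X_succ 0 a
theorem d7_X (a : A) : K.d 7 (K.X a) = K.X (K.d 7 a) + K.d 6 a := K.d_X_succ 1 a
theorem d8_X (a : A) : K.d 8 (K.X a) = K.X (K.d 8 a) + K.d 7 a := K.d_X_succ 2 a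
theorem d9_X (a : A) : K.d 9 (K.X a) = K.X (K.d 9 a) + K.d 8 a := K.d_X_succ 3 a
theorem d10_X (a : A) : K.d 10 (K.X a) = K.X (K.d 10 a) + K.d 9 a := K.d_X_succ 4 a

theorem X_v5' : K.X (K.v 5) = K.v 6 := K.X_v5 0
theorem X_v6 : K.X (K.v 6) = K.v 7 := K.X_v5 1
theorem X_v7 : K.X (K.v 7) = K.v 8 := K.X_v5 2

/-- The element `f(u) / (2 u_x²)`. -/
def chi : A := K.F 0 * K.q ^ 2

/-- The element `f'(u) / (2 u_x)`. -/
def psi : A := K.q * K.F 1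

theorem d_chi (i : ℕ) (hi : 4 ≤ i) : K.d i K.chi = 0 := by
  simp [chi, K.d_F, K.d_q, show i ≠ 2 by omega, show i ≠ 3 by omega]

theorem d_psi (i : ℕ) (hi : 4 ≤ i) : K.d i K.psi = 0 := by
  simp [psi, K.d_F, K.d_q, show i ≠ 2 by omega, show i ≠ 3 by omega]

theorem X_chi : K.X K.chi = K.psi - 4 * K.v 4 * K.chi := by
  simp [chi, psi, K.X_F, K.X_q]
  linear_combination K.q * K.F 1 * K.q_mul

theorem X_psi : K.X K.psi = K.F 2 - 2 * K.v 4 * K.psi := by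
  simp [psi, K.X_F, K.X_q]
  linear_combination K.F 2 * K.q_mul

theorem T_chi : K.T K.chi = 2 * K.v 5 * K.psi - 2 * (4 * K.v 4 * K.v 5 + 2 * K.v 6) * K.chi := by
  simp [chi, psi, K.T_F, K.T_q]
  linear_combination 2 * K.v 5 * K.q * K.F 1 * K.q_mul

theorem T_psi : K.T K.psi = 2 * K.v 5 * K.F 2 - (4 * K.v 4 * K.v 5 + 2 * K.v 6) * K.psi := by
  simp [psi, K.T_F, K.T_q]
  linear_combination 2 * K.v 5 * K.F 2 * K.q_mul

theorem X_v4' : K.X (K.v 4) = K.v 5 - K.chi + K.v 4 ^ 2 := K.X_v4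

theorem T_v4' : K.T (K.v 4) =
    K.v 7 + 2 * (K.v 5 - K.chi + K.v 4 ^ 2) * K.v 5 + 2 * K.v 4 * K.v 6 := K.T_v4

/-- The coefficient `3 u_t / u_x - 4 f(u) / u_x²`. -/
def m : A := 6 * K.v 5 - 8 * K.chi

theorem d_m (i : ℕ) (hi : 6 ≤ i) : K.d i K.m = 0 := by
  simp [m, K.d_v, K.d_chi i (by omega), show i ≠ 5 by omega]

theorem d5_m : K.d 5 K.m = 6 := by simp [m, K.d_v, K.d_chi]
theorem d4_m : K.d 4 K.m = 0 := by simp [m, K.d_v, K.d_chi]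

theorem X_m : K.X K.m = 6 * K.v 6 - 8 * K.X K.chi := by simp [m, K.X_v5']

/-- The time derivative of `ω₀`. -/
def flow : A := K.v 8 + K.m * K.v 6

theorem T_v5' : K.T (K.v 5) = K.flow := K.T_v5 0
theorem T_v6 : K.T (K.v 6) = K.X K.flow := K.T_v5 1
theorem T_v7 : K.T (K.v 7) = K.X (K.X K.flow) := K.T_v5 2
theorem T_v8 : K.T (K.v 8) = K.X (K.X (K.X K.flow)) := K.T_v5 3

/-! ### Levels and the kernel of `X` -/

/-- `a` is a function of the first `n` coordinates. -/
def Lvl (n : ℕ) (a : A) : Prop := ∀ i, n ≤ i → K.d i a = 0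

variable {K}

theorem Lvl.d {n : ℕ} {a : A} (h : K.Lvl n a) (j : ℕ) : K.Lvl n (K.d j a) := fun i hi => by
  rw [K.d_comm, h i hi, map_zero]

theorem Lvl.mono {n : ℕ} {a : A} (h : K.Lvl (n + 1) a) (h' : K.d n a = 0) : K.Lvl n a :=
  fun i hi => by
    rcases hi.eq_or_lt with rfl | hi
    · exact h'
    · exact h i hi

/-- An element annihilated by the total derivative `X` depends on `t` only. -/
theorem tOnly {a : A} (hX : K.X a = 0) {n : ℕ} (h : K.Lvl n a) : K.Lvl 1 a := by
  -- If `X a = 0` and `a` is free of `ω_{n+1}`, the commutator with `X` shows that it is free of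
  -- `ωₙ`. The same descent then continues through `η`, `p`, `u` and `x`.
  have h5 : ∀ n, K.Lvl (n + 5) a → K.Lvl 5 a := by
    intro n
    induction n with
    | zero => exact id
    | succ n ih =>
      intro h
      refine ih (h.mono ?_)
      have := K.d_X_succ n a
      rw [hX, h (n + 6) (by omega)] at this
      simpa using this.symm
  have h5 : K.Lvl 5 a := h5 n fun i hi => h i (by omega)
  have h4 : K.Lvl 4 a := h5.mono (by simpa [hX, h5 5] using (K.d5_X a).symm)
  have h3 : K.Lvl 3 a := h4.mono (by
    have := K.d4_X a
    simp only [hX, h4 4 le_rfl, map_zero, mul_zero, add_zero, zero_add] at this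
    refine eq_zero_of_ofNat_mul 2 ?_
    linear_combination (-2 * K.d 3 a) * K.q_mul - K.q * this)
  have h2 : K.Lvl 2 a := h3.mono (by
    have := K.d3_X a
    simp only [hX, h3 3 le_rfl, h3 4 (by omega), map_zero, mul_zero, add_zero, zero_add] at this
    exact this.symm)
  refine h2.mono ?_
  have := K.X_eq 2 a h2
  rw [hX] at this
  simpa [Finset.sum_range_succ, K.X_v0, K.X_v1] using this.symm

theorem X_tOnly {a : A} (h : K.Lvl 1 a) : K.X a = 0 := by
  rw [K.X_eq 1 a h]; simp [K.X_v0]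

theorem T_tOnly {a : A} (h : K.Lvl 1 a) : K.T a = K.d 0 a := by
  rw [K.T_eq 1 a h]; simp [K.T_v0]

theorem T_nine {a : A} (h : K.Lvl 9 a) : K.T a = K.d 0 a + 2 * K.v 3 * K.v 5 * K.d 2 a +
    K.v 3 * (4 * K.v 4 * K.v 5 + 2 * K.v 6) * K.d 3 a +
    (K.v 7 + 2 * (K.v 5 - K.chi + K.v 4 ^ 2) * K.v 5 + 2 * K.v 4 * K.v 6) * K.d 4 a +
    K.flow * K.d 5 a + K.X K.flow * K.d 6 a + K.X (K.X K.flow) * K.d 7 a +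
    K.X (K.X (K.X K.flow)) * K.d 8 a := by
  rw [K.T_eq 9 a h]
  simp [Finset.sum_range_succ, K.T_v0, K.T_v1, K.T_v2, K.T_v3, K.T_v4', K.T_v5', K.T_v6, K.T_v7,
    K.T_v8]

/-! ### Solving the determining equation in the frame -/

variable (K)

/-- The determining operator in the frame. -/
def E (a : A) : A := K.T a - K.X (K.X (K.X a)) - K.m * K.X a

variable {K}

/-- In the `ω₅`-derivative of `E S` the contributions of `T` and `X³` through `∂S/∂ω₂` cancel,
leaving `-3 X(∂S/∂ω₃)`. -/
theorem lvl1_d8 {S : A} (h : K.Lvl 9 S) (hE : K.E S = 0) : K.Lvl 1 (K.d 8 S) := by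
  have h' : ∀ i j, 9 ≤ i → K.d i (K.d j S) = 0 := fun i j hi => h.d j i hi
  have e := congrArg (K.d 10) hE
  rw [E, T_nine h] at e
  simp [flow, K.d10_X, K.d9_X, K.d8_X, K.d_v, K.d_m, K.d_chi, h', h 9, h 10] at e
  exact tOnly (eq_zero_of_ofNat_mul 3 (by linear_combination -e)) (h.d 8)

theorem lvl1_d7 {S : A} (h : K.Lvl 9 S) (h8 : K.Lvl 1 (K.d 8 S)) (hE : K.E S = 0) :
    K.Lvl 1 (K.d 7 S) := by
  have h' : ∀ i j, 9 ≤ i → K.d i (K.d j S) = 0 := fun i j hi => h.d j i hi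
  have e := congrArg (K.d 9) hE
  rw [E, T_nine h] at e
  simp [flow, K.d9_X, K.d8_X, K.d7_X, K.d_v, K.d_m, K.d_chi, h', X_tOnly h8, h 9] at e
  exact tOnly (eq_zero_of_ofNat_mul 3 (by linear_combination -e)) (h.d 7)

/-- The `ω₃`-derivative of `E S` is, up to sign, `X` of the displayed element: `∂S/∂ω₃` depends on
`t` only, and the inhomogeneous terms integrate because `X ω₀ = ω₁` and `X x = 1`. -/
theorem d6_eq {S : A} (h : K.Lvl 9 S) (h8 : K.Lvl 1 (K.d 8 S)) (h7 : K.Lvl 1 (K.d 7 S))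
    (hE : K.E S = 0) :
    K.Lvl 1 (3 * K.d 6 S - K.d 8 S * (24 * K.v 5 - 24 * K.chi) - K.d 0 (K.d 8 S) * K.v 1) := by
  have h8' : ∀ j, 1 ≤ j → K.d 8 (K.d j S) = 0 := fun j hj => by rw [K.d_comm, h8 j hj]
  have h80 : K.d 8 (K.d 0 S) = K.d 0 (K.d 8 S) := K.d_comm _ _ _
  have e := congrArg (K.d 8) hE
  rw [E, T_nine h] at e
  simp [flow, K.d8_X, K.d7_X, K.d6_X, K.d5_X, K.d_v, K.d_m, K.d_chi, K.d5_m, h8', h80,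
    X_tOnly h8, X_tOnly h7] at e
  refine tOnly ?_ (n := 9) ?_
  · simp [K.X_v5', K.X_v1, X_tOnly h8, X_tOnly (h8.d 0)]
    rw [K.X_m] at e
    linear_combination -e
  · intro i hi
    simp [K.d_v, K.d_chi i (by omega), h.d 6 i hi, h.d 8 i hi, (h.d 8).d 0 i hi,
      show i ≠ 5 by omega, show i ≠ 1 by omega]

theorem d8_eq_zero {S : A} (h : K.Lvl 9 S) (h8 : K.Lvl 1 (K.d 8 S)) (h7 : K.Lvl 1 (K.d 7 S))
    (h6 : K.Lvl 1 (3 * K.d 6 S - K.d 8 S * (24 * K.v 5 - 24 * K.chi) - K.d 0 (K.d 8 S) * K.v 1))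
    (hE : K.E S = 0) : K.d 8 S = 0 := by
  have h7' : ∀ j, 1 ≤ j → K.d 7 (K.d j S) = 0 := fun j hj => by rw [K.d_comm, h7 j hj]
  have h70 : K.d 7 (K.d 0 S) = K.d 0 (K.d 7 S) := K.d_comm _ _ _
  have h770 : K.d 7 (K.d 0 (K.d 7 S)) = 0 := h7.d 0 _ (by norm_num)
  have h66 : K.d 6 (K.d 6 S) = 0 := by
    have e := h6 6 (by norm_num)
    simp [K.d_v, K.d_chi, h8 6, h8.d 0 6] at e
    exact eq_zero_of_ofNat_mul 3 e
  have h56 : K.d 5 (K.d 6 S) = 8 * K.d 8 S := by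
    have e := h6 5 (by norm_num)
    simp [K.d_v, K.d_chi, h8 5, h8.d 0 5] at e
    exact sub_eq_zero.1 (eq_zero_of_ofNat_mul 3 (by linear_combination e))
  have h65 : K.d 6 (K.d 5 S) = 8 * K.d 8 S := by rw [K.d_comm, h56]
  have e := congrArg (K.d 7) (congrArg (K.d 7) hE)
  rw [E, T_nine h] at e
  simp [flow, K.d8_X, K.d7_X, K.d6_X, K.d5_X, K.d_v, K.d_m, K.d_chi, K.d5_m, h7', h70, h770,
    h66, h56, h65,  h7 4, h7 5, h7 6,h7 7, X_tOnly h8, X_tOnly h7] at e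
  -- Coefficient of `ω₂²` with `s = ∂S/∂ω₃`: `X³(mω₁)` contributes `18s`, while the term `8sω₀ω₁` of
  -- `S` found through `d6_eq` contributes `-24s` via `-X³S`. Their sum `-6s` is doubled by the
  -- second derivative.
  refine eq_zero_of_ofNat_mul 12 ?_
  have hm : K.d 7 (K.d 4 K.m) = 0 := by rw [K.d4_m, map_zero]
  rw [hm] at e
  linear_combination -e

/-- The analogue of `d6_eq` one order lower: the `ω₂`-derivative of `E S` is again a total
`x`-derivative. -/
theorem d5_eq {S : A} (h : K.Lvl 8 S) (h7 : K.Lvl 1 (K.d 7 S)) (h6 : K.Lvl 1 (K.d 6 S)) (hE : K.E S = 0) :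
    K.Lvl 1 (3 * K.d 5 S - K.d 0 (K.d 7 S) * K.v 1 - 18 * K.d 7 S * K.v 5 +
      16 * K.d 7 S * K.chi) := by
  have h7' : ∀ j, 1 ≤ j → K.d 7 (K.d j S) = 0 := fun j hj => by rw [K.d_comm, h7 j hj]
  have h70 : K.d 7 (K.d 0 S) = K.d 0 (K.d 7 S) := K.d_comm _ _ _
  have e := congrArg (K.d 7) hE
  rw [E, T_nine (fun i hi => h i (by omega)), h 8 le_rfl] at e
  simp [flow, K.d8_X, K.d7_X, K.d6_X, K.d5_X, K.d_v, K.d_m, K.d_chi, K.d5_m, h7', h70,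
     X_tOnly h6, X_tOnly h7] at e
  refine tOnly ?_ (n := 8) ?_
  · simp [K.X_v5', K.X_v1, X_tOnly h7, X_tOnly (h7.d 0)]
    rw [K.X_m] at e
    linear_combination -e
  · intro i hi
    simp [K.d_v, K.d_chi i (by omega), h.d 5 i hi, h.d 7 i hi, (h.d 7).d 0 i hi,
      show i ≠ 5 by omega, show i ≠ 1 by omega]

/-- The obstruction is the term `6ω₁²` of `D_t ω₁`, produced by `(X m)ω₁` and multiplied by
`∂S/∂ω₁`; nothing else in `E S` is quadratic in `ω₁`. -/
theorem d6_eq_zero {S : A} (h : K.Lvl 8 S) (h7 : K.Lvl 1 (K.d 7 S)) (h6 : K.Lvl 1 (K.d 6 S))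
    (h5 : K.Lvl 1 (3 * K.d 5 S - K.d 0 (K.d 7 S) * K.v 1 - 18 * K.d 7 S * K.v 5 +
      16 * K.d 7 S * K.chi)) (hE : K.E S = 0) :
    K.d 6 S = 0 := by
  have h6' : ∀ j, 1 ≤ j → K.d 6 (K.d j S) = 0 := fun j hj => by rw [K.d_comm, h6 j hj]
  have h60 : K.d 6 (K.d 0 S) = K.d 0 (K.d 6 S) := K.d_comm _ _ _
  have h660 : K.d 6 (K.d 0 (K.d 6 S)) = 0 := h6.d 0 _ (by norm_num)
  have h55 : K.d 5 (K.d 5 S) = 6 * K.d 7 S := by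
    have e := h5 5 (by norm_num)
    simp [K.d_v, K.d_chi, h7 5, h7.d 0 5] at e
    exact sub_eq_zero.1 (eq_zero_of_ofNat_mul 3 (by linear_combination e))
  have h45 : K.d 4 (K.d 5 S) = 0 := by
    have e := h5 4 (by norm_num)
    simp [K.d_v, K.d_chi, h7 4, h7.d 0 4] at e
    exact eq_zero_of_ofNat_mul 3 e
  have h54 : K.d 5 (K.d 4 S) = 0 := by rw [K.d_comm, h45]
  have e := congrArg (K.d 6) (congrArg (K.d 6) hE)
  rw [E, T_nine (fun i hi => h i (by omega)), h 8 le_rfl] at e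
  simp [flow, K.d8_X, K.d7_X, K.d6_X, K.d5_X, K.d4_X, K.d_v, K.d_m, K.d_chi, K.d5_m, K.d4_m, h6', h60, h660,
    h55, h45, h54,  h6 4, h6 5, h6 6, X_tOnly h6, X_tOnly h7] at e
  exact eq_zero_of_ofNat_mul 12 (by linear_combination e)

variable (K) in
/-- The higher-order solution of the determining equation (up to the factor `f⁽⁵⁾`). -/
def sigma : A := 9 * K.v 7 + 27 * K.v 5 ^ 2 - 48 * K.chi * K.v 5 - 48 * K.v 4 ^ 2 * K.chi +
  24 * K.v 4 * K.psi + 16 * K.chi ^ 2 - 4 * K.F 2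

variable (K) in
theorem E_sigma : K.E K.sigma = 4 * K.F 5 * K.v 3 ^ 3 := by
  refine determining_sigma K.X K.T (η := K.v 4) K.X_v3 K.X_v4' K.X_chi K.X_psi (K.X_F 2) (K.X_F 3)
    (K.X_F 4) ?_ ?_ ?_ ?_ ?_ (K.T_F 2) ?_
  · simp only [K.X_v5', K.X_v6, K.T_v4']
  · simp only [K.X_v5', K.X_v6, K.X_v7, K.T_v5', flow, m]
  · simp only [K.X_v5', K.X_v6, K.T_v5', K.T_v7]
  · simp only [K.X_v5', K.T_chi]
  · simp only [K.X_v5', K.T_psi]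
  · simp only [K.X_v5', K.X_v6, sigma]

variable (K) in
-- For the `ωₖ` commutation is built into `T_v5`; for `p` and `η` it is the computation that
-- dictates the flows of `η` and `ω₀`.
theorem X_T_v (i : ℕ) : K.X (K.T (K.v i)) = K.T (K.X (K.v i)) := by
  match i with
  | 0 => simp [K.T_v0, K.X_v0]
  | 1 => simp [K.T_v1, K.X_v1]
  | 2 => simp [K.T_v2, K.X_v2, K.X_v3, K.X_v5', K.T_v3]; ring
  | 3 =>
    simp [K.T_v3, K.X_v3, K.X_v4', K.X_v5', K.X_v6, K.T_v4']; ring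
  | 4 =>
    simp [K.T_v3, K.X_v3, K.X_v4', K.X_v5', K.X_v6, K.X_v7, K.T_v4', K.X_chi, K.T_chi, K.T_v5', flow, m]
    ring
  | k + 5 => rw [K.X_v5, K.T_v5, K.T_v5 (k + 1), Function.iterate_succ_apply']

/-- Here `R` is what remains of `9S` after subtracting the `σ` and `ω₀` parts. The `ω₁`-derivative
of its equation leaves only `-3 X(∂R/∂η)`. -/
theorem d4_tOnly {R δ γ : A} (hR : K.Lvl 5 R) (hδ : K.Lvl 1 δ) (hγ : K.Lvl 1 γ)
    (hE : K.E R = - (K.d 0 δ * K.sigma + 4 * δ * K.F 5 * K.v 3 ^ 3) -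
      3 * (K.d 0 (K.d 0 δ) * K.v 1 + K.d 0 γ) * K.v 5 + 9 * K.d 0 δ * K.v 7 +
      3 * K.m * K.d 0 δ * K.v 5) : K.Lvl 1 (K.d 4 R) := by
  have hR' : ∀ i j, 5 ≤ i → K.d i (K.d j R) = 0 := fun i j hi => hR.d j i hi
  have e := congrArg (K.d 6) hE
  rw [E, T_nine (fun i hi => hR i (by omega)), hR 5 le_rfl, hR 6 (by norm_num), hR 7 (by norm_num),
    hR 8 (by norm_num)] at e
  simp [sigma, K.d6_X, K.d5_X, K.d4_X, K.d_m, K.d_chi, K.d_v, K.d_F, K.d_psi, hR', hR 6, hR 5,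
    hδ 6, hγ 6, hδ.d 0 6, hγ.d 0 6, (hδ.d 0).d 0 6] at e
  exact tOnly (eq_zero_of_ofNat_mul 3 (by linear_combination -e)) (hR.d 4)

/-- Applying `∂_η² ∂_{ω₀}` isolates `24 ∂R/∂η`; once this vanishes, `∂_{ω₀}²` isolates `18 δ_t`. -/
theorem d4_eq_zero {R δ γ : A} (hR : K.Lvl 5 R) (hδ : K.Lvl 1 δ) (hγ : K.Lvl 1 γ)
    (h4 : K.Lvl 1 (K.d 4 R))
    (hE : K.E R = - (K.d 0 δ * K.sigma + 4 * δ * K.F 5 * K.v 3 ^ 3) -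
      3 * (K.d 0 (K.d 0 δ) * K.v 1 + K.d 0 γ) * K.v 5 + 9 * K.d 0 δ * K.v 7 +
      3 * K.m * K.d 0 δ * K.v 5) : K.d 4 R = 0 ∧ K.d 0 δ = 0 := by
  have hR' : ∀ i j, 5 ≤ i → K.d i (K.d j R) = 0 := fun i j hi => hR.d j i hi
  have h4' : ∀ j, 1 ≤ j → K.d 4 (K.d j R) = 0 := fun j hj => by rw [K.d_comm, h4 j hj]
  have h40 : K.d 4 (K.d 0 R) = K.d 0 (K.d 4 R) := K.d_comm _ _ _
  have h433 : K.d 4 (K.d 3 (K.d 3 R)) = 0 := by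
    rw [K.d_comm, h4' 3 (by norm_num), map_zero]
  rw [E, T_nine (fun i hi => hR i (by omega)), hR 5 le_rfl, hR 6 (by norm_num), hR 7 (by norm_num),
    hR 8 (by norm_num)] at hE
  have e := congrArg (K.d 5) (congrArg (K.d 5) hE)
  have e2 := congrArg (K.d 4) (congrArg (K.d 4) (congrArg (K.d 5) hE))
  simp [sigma, K.d6_X, K.d5_X, K.d4_X, K.d3_X, K.d_m, K.d5_m, K.d4_m, K.d_chi, K.d_v, K.d_F, K.d_q, h433, K.d_psi, hR', hR 6, hR 5,
    h4', h40, hδ 5, hγ 5, hδ.d 0 5, hγ.d 0 5, (hδ.d 0).d 0 5,hδ 4, hγ 4, hδ.d 0 4, hγ.d 0 4, (hδ.d 0).d 0 4, X_tOnly h4] at e e2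
  have k0 : K.d 4 R = 0 := eq_zero_of_ofNat_mul 24 (by linear_combination -e2)
  rw [k0] at e
  exact ⟨k0, eq_zero_of_ofNat_mul 18 (by linear_combination e)⟩

variable (K) in
/-- The remaining determining equation for functions of `t, x, u, p`. -/
def Rest (R δ γ : A) : Prop :=
  K.E R = - (4 * δ * K.F 5 * K.v 3 ^ 3) - 3 * K.d 0 γ * K.v 5

/-- This Euler equation in `p`, read off from the `ηω₀` terms, says that `p² R_p` is free of `p`;
its solutions are `R = α/p + β`. -/
theorem d33_eq {R δ γ : A} (hR : K.Lvl 4 R) (hδ : K.Lvl 1 δ) (hγ : K.Lvl 1 γ)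
    (hE : K.Rest R δ γ) : K.v 3 * K.d 3 (K.d 3 R) + 2 * K.d 3 R = 0 := by
  have hR' : ∀ i j, 4 ≤ i → K.d i (K.d j R) = 0 := fun i j hi => hR.d j i hi
  have hR'' : ∀ i j k, 4 ≤ i → K.d i (K.d j (K.d k R)) = 0 := fun i j k hi => (hR.d k).d j i hi
  rw [Rest, E, T_nine (fun i hi => hR i (by omega)), hR 4 le_rfl, hR 5 (by norm_num),
    hR 6 (by norm_num), hR 7 (by norm_num), hR 8 (by norm_num)] at hE
  have e := congrArg (K.d 4) (congrArg (K.d 5) hE)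
  simp [K.d5_X, K.d4_X, K.d3_X, K.d_m, K.d5_m, K.d4_m, K.d_v, K.d_F, K.d_q, K.d_chi, hR', hR'', hR 5, hR 4,
    hδ 5, hγ 5, hγ.d 0 5, hδ 4, hγ 4, hγ.d 0 4] at e
  refine eq_zero_of_ofNat_mul 12 ?_
  linear_combination -K.q * e - 12 * (K.v 3 * K.d 3 (K.d 3 R) + 2 * K.d 3 R) * K.q_mul

/-- The `ω₀`-derivative gives `2(β_x + pβ_u) = γ_t`, which splits in `p`. -/
theorem rest_low {α β δ γ : A} (hα : K.Lvl 3 α) (hβ : K.Lvl 3 β) (hδ : K.Lvl 1 δ) (hγ : K.Lvl 1 γ)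
    (hE : K.Rest (K.q * α + β) δ γ) : K.d 2 β = 0 ∧ 2 * K.d 1 β = K.d 0 γ := by
  have h3 : ∀ i j, 3 ≤ i → K.d i (K.d j α) = 0 := fun i j hi => hα.d j i hi
  have h3' : ∀ i j, 3 ≤ i → K.d i (K.d j β) = 0 := fun i j hi => hβ.d j i hi
  have h33 : ∀ i j k, 3 ≤ i → K.d i (K.d k (K.d j α)) = 0 := fun i j k hi => (hα.d j).d k i hi
  have h33' : ∀ i j k, 3 ≤ i → K.d i (K.d k (K.d j β)) = 0 := fun i j k hi => (hβ.d j).d k i hi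
  have hR : K.Lvl 4 (K.q * α + β) := fun i hi => by
    simp [hα i (by omega), hβ i (by omega), K.d_q, show i ≠ 3 by omega]
  have hXα : K.X α = K.d 1 α + K.v 3 * K.d 2 α := by
    rw [K.X_eq 3 α hα]; simp [Finset.sum_range_succ, K.X_v0, K.X_v1, K.X_v2]
  have hXβ : K.X β = K.d 1 β + K.v 3 * K.d 2 β := by
    rw [K.X_eq 3 β hβ]; simp [Finset.sum_range_succ, K.X_v0, K.X_v1, K.X_v2]
  rw [Rest, E, T_nine (fun i hi => hR i (by omega)), hR 4 le_rfl, hR 5 (by norm_num),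
    hR 6 (by norm_num), hR 7 (by norm_num), hR 8 (by norm_num)] at hE
  have e := congrArg (K.d 5) hE
  simp [K.X_q, K.X_v3, K.X_v4', hXα, hXβ, K.d5_X, K.d4_X, K.d3_X, K.d_m, K.d5_m, K.d4_m, K.d_v, K.d_F, K.d_q, K.d_chi, h3, h3', h33, h33', hα 3, hβ 3, hα 5, hβ 5, hα 4, hβ 4, hδ 5, hγ 5, hγ.d 0 5, hδ 4, hγ 4, hγ.d 0 4] at e
  have e1 : 2 * (K.d 1 β + K.v 3 * K.d 2 β) = K.d 0 γ := by
    refine sub_eq_zero.1 (eq_zero_of_ofNat_mul 3 ?_)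
    linear_combination -e - 4 * α * K.q * K.v 4 * K.q_mul
  have e2 := congrArg (K.d 3) e1
  simp [h3', K.d_v, hγ.d 0 3] at e2
  have e3 : K.d 2 β = 0 := eq_zero_of_ofNat_mul 2 (by linear_combination e2)
  refine ⟨e3, ?_⟩
  rw [e3] at e1
  linear_combination e1

/-- With `β_u = 0`, the second `η`-derivative of the equation retains only a multiple of `α_x`. -/
theorem rest_alpha {α β δ γ : A} (hα : K.Lvl 3 α) (hβ : K.Lvl 3 β) (hδ : K.Lvl 1 δ) (hγ : K.Lvl 1 γ)
    (hE : K.Rest (K.q * α + β) δ γ) : K.d 1 α = 0 := by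
  have h3 : ∀ i j, 3 ≤ i → K.d i (K.d j α) = 0 := fun i j hi => hα.d j i hi
  have h3' : ∀ i j, 3 ≤ i → K.d i (K.d j β) = 0 := fun i j hi => hβ.d j i hi
  have h33 : ∀ i j k, 3 ≤ i → K.d i (K.d k (K.d j α)) = 0 := fun i j k hi => (hα.d j).d k i hi
  have h33' : ∀ i j k, 3 ≤ i → K.d i (K.d k (K.d j β)) = 0 := fun i j k hi => (hβ.d j).d k i hi
  have hR : K.Lvl 4 (K.q * α + β) := fun i hi => by
    simp [hα i (by omega), hβ i (by omega), K.d_q, show i ≠ 3 by omega]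
  have hXα : K.X α = K.d 1 α + K.v 3 * K.d 2 α := by
    rw [K.X_eq 3 α hα]; simp [Finset.sum_range_succ, K.X_v0, K.X_v1, K.X_v2]
  have hXβ : K.X β = K.d 1 β + K.v 3 * K.d 2 β := by
    rw [K.X_eq 3 β hβ]; simp [Finset.sum_range_succ, K.X_v0, K.X_v1, K.X_v2]
  have hE0 := hE
  rw [Rest, E, T_nine (fun i hi => hR i (by omega)), hR 4 le_rfl, hR 5 (by norm_num),
    hR 6 (by norm_num), hR 7 (by norm_num), hR 8 (by norm_num)] at hE
  have e := congrArg (K.d 4) (congrArg (K.d 4) hE)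
  simp [K.X_q, K.X_v3, K.X_v4', hXα, hXβ, K.d5_X, K.d4_X, K.d3_X, K.d_m, K.d5_m, K.d4_m, K.d_v, K.d_F, K.d_q, K.d_chi, h3, h3', h33, h33', hα 3, hβ 3, hα 5, hβ 5, hα 4, hβ 4, hδ 5, hγ 5, hγ.d 0 5, hδ 4, hγ 4, hγ.d 0 4] at e
  have h43 : K.d 4 (K.d 3 K.chi) = 0 := by rw [K.d_comm, K.d_chi 4 le_rfl, map_zero]
  have hq := K.q_mul
  rw [h43, (rest_low hα hβ hδ hγ hE0).1] at e
  have e2 : 12 * K.d 1 α = 0 := by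
    clear hE hE0 hXα hXβ hR h3 h3' h33 h33' h43 hα hβ hδ hγ
    generalize K.q = q at *
    generalize K.v 3 = p at *
    generalize K.d 1 α = α1 at *
    generalize K.d 2 α = α2 at *
    grind
  exact eq_zero_of_ofNat_mul 12 e2

/-- After the `η` and `ω₀` terms have cancelled, multiplying the equation by `p²` clears
denominators and leaves a polynomial in `p` whose coefficients are free of `p`. -/
theorem rest_eq {α β δ γ : A} (hα : K.Lvl 3 α) (hβ : K.Lvl 3 β) (hγ : K.Lvl 1 γ)
    (hα1 : K.d 1 α = 0) (hβ2 : K.d 2 β = 0) (hβ1 : 2 * K.d 1 β = K.d 0 γ)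
    (hE : K.Rest (K.q * α + β) δ γ) :
    4 * δ * K.F 5 * K.v 3 ^ 5 + K.d 0 α * K.v 3 + K.d 0 β * K.v 3 ^ 2
      - K.d 2 (K.d 2 (K.d 2 α)) * K.v 3 ^ 4
      + (4 * K.F 0 * K.d 2 α - 2 * K.F 1 * α + 8 * K.F 0 * K.d 1 β) = 0 := by
  have hR : K.Lvl 4 (K.q * α + β) := fun i hi => by
    simp [hα i (by omega), hβ i (by omega), K.d_q, show i ≠ 3 by omega]
  have hα1' : ∀ j, K.d 1 (K.d j α) = 0 := fun j => by rw [K.d_comm, hα1, map_zero]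
  have hα1'' : ∀ i j, K.d 1 (K.d i (K.d j α)) = 0 := fun i j => by rw [K.d_comm, hα1', map_zero]
  have hX : ∀ a, K.Lvl 3 a → K.d 1 a = 0 → K.X a = K.v 3 * K.d 2 a := fun a ha ha1 => by
    rw [K.X_eq 3 a ha]; simp [Finset.sum_range_succ, K.X_v0, K.X_v1, K.X_v2, ha1]
  have hXβ : K.X β = K.d 1 β := by
    rw [K.X_eq 3 β hβ]; simp [Finset.sum_range_succ, K.X_v0, K.X_v1, K.X_v2, hβ2]
  have hβ1' : K.Lvl 1 (K.d 1 β) := fun i hi => by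
    refine eq_zero_of_ofNat_mul 2 ?_
    have := congrArg (K.d i) hβ1
    simpa [hγ.d 0 i hi] using this
  rw [Rest, E, T_nine (fun i hi => hR i (by omega)), hR 4 le_rfl, hR 5 (by norm_num),
    hR 6 (by norm_num), hR 7 (by norm_num), hR 8 (by norm_num)] at hE
  simp [K.X_q, K.X_v3, K.X_v4', K.X_v5', K.X_chi, hX α hα hα1, hX _ (hα.d 2) (hα1' _), hX _ ((hα.d 2).d 2) (hα1'' _ _),
    hXβ, X_tOnly hβ1', K.d_q, hα 3, hβ 3, hβ2, m] at hE
  have h0 : K.chi * K.v 3 ^ 2 = K.F 0 := by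
    rw [chi]; linear_combination K.F 0 * (K.q * K.v 3 + 1) * K.q_mul
  have h1 : K.psi * K.v 3 = K.F 1 := by
    rw [psi]; linear_combination K.F 1 * K.q_mul
  have hq := K.q_mul
  rw [← hβ1] at hE
  rw [← h0, ← h1]
  clear hX hXβ hR hα1' hα1'' hα hβ hγ hβ1 hα1 hβ2 hβ1' h0 h1
  generalize K.d 2 (K.d 2 (K.d 2 α)) = α222 at *
  generalize K.d 2 (K.d 2 α) = α22 at *
  generalize K.d 2 α = α2 at *
  generalize K.d 0 α = α0 at *
  generalize K.d 0 β = β0 at *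
  generalize K.d 1 β = β1 at *
  generalize K.q = q at *
  generalize K.v 3 = p at *
  grind

/-- Repeated `∂_p` peels off the coefficients from the top degree downwards. -/
theorem poly_eq_zero {a₀ a₁ a₂ a₄ a₅ : A} (h0 : K.d 3 a₀ = 0) (h1 : K.d 3 a₁ = 0)
    (h2 : K.d 3 a₂ = 0) (h4 : K.d 3 a₄ = 0) (h5 : K.d 3 a₅ = 0)
    (h : a₅ * K.v 3 ^ 5 + a₁ * K.v 3 + a₂ * K.v 3 ^ 2 + a₄ * K.v 3 ^ 4 + a₀ = 0) :
    a₁ = 0 ∧ a₂ = 0 ∧ a₄ = 0 ∧ a₅ = 0 := by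
  have e1 := congrArg (K.d 3) h
  have e2 := congrArg (K.d 3) (congrArg (K.d 3) h)
  have e4 := congrArg (K.d 3) (congrArg (K.d 3) (congrArg (K.d 3) (congrArg (K.d 3) h)))
  have e5 := congrArg (K.d 3) (congrArg (K.d 3) (congrArg (K.d 3) (congrArg (K.d 3)
    (congrArg (K.d 3) h))))
  simp [K.d_v, h0, h1, h2, h4, h5] at e1 e2 e4 e5
  have r5 : a₅ = 0 := eq_zero_of_ofNat_mul 120 (by linear_combination e5)
  have r4 : a₄ = 0 := eq_zero_of_ofNat_mul 24 (by rw [r5] at e4; linear_combination e4)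
  have r2 : a₂ = 0 := eq_zero_of_ofNat_mul 2 (by rw [r5, r4] at e2; linear_combination e2)
  exact ⟨by rw [r5, r4, r2] at e1; linear_combination e1, r2, r4, r5⟩

/-- The general solution of the determining equation among functions of the first nine
coordinates. -/
theorem solution {S : A} (h : K.Lvl 9 S) (hE : K.E S = 0) :
    ∃ δ γ α β : A, K.Lvl 1 δ ∧ K.d 0 δ = 0 ∧ K.Lvl 1 γ ∧ K.Lvl 3 α ∧ K.Lvl 3 β ∧ δ * K.F 5 = 0 ∧
      K.d 0 α = 0 ∧ K.d 1 α = 0 ∧ K.d 2 (K.d 2 (K.d 2 α)) = 0 ∧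
      K.d 0 β = 0 ∧ K.d 2 β = 0 ∧ 2 * K.d 1 β = K.d 0 γ ∧
      9 * S = δ * K.sigma + 3 * γ * K.v 5 + K.q * α + β := by
  have h8 := lvl1_d8 h hE
  have h7 := lvl1_d7 h h8 hE
  have c8 := d8_eq_zero h h8 h7 (d6_eq h h8 h7 hE) hE
  have hS8 : K.Lvl 8 S := h.mono c8
  have h6 : K.Lvl 1 (K.d 6 S) := by
    have := d6_eq h h8 h7 hE
    rw [c8] at this
    intro i hi
    have := this i hi
    simp at this
    exact eq_zero_of_ofNat_mul 3 this
  have h5 := d5_eq hS8 h7 h6 hE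
  have c6 := d6_eq_zero hS8 h7 h6 h5 hE
  -- `δ` and `γ` are functions of `t` by the previous reductions. The combination `R` is chosen to
  -- cancel the `ω₂`- and `ω₀`-derivatives of `9S`; the factor 9 matches the leading term `9ω₂` of
  -- `σ`.
  set δ := K.d 7 S with hδ
  set γ := 3 * K.d 5 S - K.d 0 δ * K.v 1 - 18 * δ * K.v 5 + 16 * δ * K.chi with hγ
  set R := 9 * S - δ * K.sigma - 3 * (K.d 0 δ * K.v 1 + γ) * K.v 5 with hR
  have hR5 : K.Lvl 5 R := by
    intro i hi
    have e1 := h7 i (by omega)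
    have e2 := h5 i (by omega)
    have e3 := h7.d 0 i (by omega)
    have hS : i ≠ 5 → i ≠ 7 → K.d i S = 0 := fun a b => by
      rcases (show i = 6 ∨ 8 ≤ i by omega) with rfl | hi8
      · exact c6
      · exact hS8 i hi8
    rw [hR, sigma]
    simp only [map_sub, map_add, Derivation.leibniz, smul_eq_mul, e1, e2, e3, K.d_v,
      K.d_chi i (by omega), K.d_psi i (by omega), K.d_F, derivation_ofNat, Derivation.leibniz_pow]
    by_cases i5 : i = 5
    · subst i5; simp; rw [hγ]; ring
    by_cases i7 : i = 7
    · subst i7; simp; rw [hδ]; ring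
    simp [hS i5 i7, i5, i7, show i ≠ 1 by omega, show i ≠ 4 by omega, show i ≠ 2 by omega]
  have hER : K.E R = - (K.d 0 δ * K.sigma + 4 * δ * K.F 5 * K.v 3 ^ 3) -
      3 * (K.d 0 (K.d 0 δ) * K.v 1 + K.d 0 γ) * K.v 5 + 9 * K.d 0 δ * K.v 7 +
      3 * K.m * K.d 0 δ * K.v 5 := by
    have e0 := K.E_sigma
    rw [E] at e0 hE ⊢
    have x0 : K.X γ = 0 := X_tOnly h5
    have t0 : K.T γ = K.d 0 γ := T_tOnly h5
    clear_value γ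
    rw [hR]
    clear_value R
    simp [X_tOnly h7, X_tOnly (h7.d 0), T_tOnly h7, T_tOnly (h7.d 0), x0, t0, K.X_v1, K.T_v1,
      K.X_v5', K.X_v6, K.X_v7, K.T_v5', flow]
    linear_combination 9 * hE - δ * e0
  have h4 := d4_tOnly hR5 h7 h5 hER
  obtain ⟨c4, cδ⟩ := d4_eq_zero hR5 h7 h5 h4 hER
  have hR4 : K.Lvl 4 R := hR5.mono c4
  have hrest : K.Rest R δ γ := by
    rw [Rest, hER, cδ]; simp
  have h33 := d33_eq hR4 h7 h5 hrest
  -- If `R = α/p + β`, then `R_p = -α/p²`, which dictates this choice of `α`.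
  set α := - (K.v 3 ^ 2 * K.d 3 R) with hα
  set β := R - K.q * α with hβ
  have hα3 : K.Lvl 3 α := by
    intro i hi
    rcases hi.eq_or_lt with rfl | hi
    · simp [hα, K.d_v]; linear_combination -K.v 3 * h33
    · simp [hα, K.d_v, hR4.d 3 i hi, show i ≠ 3 by omega]
  have hβ3 : K.Lvl 3 β := by
    intro i hi
    rcases hi.eq_or_lt with rfl | hi
    · simp only [hβ, map_sub, Derivation.leibniz, hα3 3 le_rfl, K.d_q, smul_eq_mul]
      simp [hα]
      linear_combination -(K.d 3 R) * (K.q * K.v 3 + 1) * K.q_mul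
    · simp [hβ, K.d_q, hR4 i hi, hα3 i (by omega), show i ≠ 3 by omega]
  have hαβ : K.q * α + β = R := by rw [hβ]; ring
  rw [← hαβ] at hrest
  obtain ⟨b2, b1⟩ := rest_low hα3 hβ3 h7 h5 hrest
  have a1 := rest_alpha hα3 hβ3 h7 h5 hrest
  have hβ1 : K.Lvl 3 (K.d 1 β) := hβ3.d 1
  have hp := rest_eq hα3 hβ3 h5 a1 b2 b1 hrest
  have h3 : (3 : ℕ) ≤ 3 := le_rfl
  -- The coefficient `a₀` carries the condition on `f` for point symmetries. It can be dropped: the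
  -- remainder of a characteristic will be a symmetry as a difference of two symmetries.
  obtain ⟨p1, p2, p4, p5⟩ := poly_eq_zero (K := K)
    (a₀ := 4 * K.F 0 * K.d 2 α - 2 * K.F 1 * α + 8 * K.F 0 * K.d 1 β)
    (a₁ := K.d 0 α) (a₂ := K.d 0 β) (a₄ := - K.d 2 (K.d 2 (K.d 2 α))) (a₅ := 4 * δ * K.F 5)
    (by simp [K.d_F, hα3.d 2 3, hα3 3, hβ1 3]) (hα3.d 0 3 h3) (hβ3.d 0 3 h3)
    (by rw [map_neg, (((hα3.d 2).d 2).d 2) 3 h3, neg_zero])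
    (by simp [K.d_F, h7 3]) (by linear_combination hp)
  refine ⟨δ, γ, α, β, h7, cδ, h5, hα3, hβ3, eq_zero_of_ofNat_mul 4 (by linear_combination p5),
    p1, a1, neg_eq_zero.1 p4, p2, b2, b1, ?_⟩
  rw [cδ] at hR
  linear_combination -hR + (- hαβ)

/-- The general solution in terms of constants. -/
theorem solution_const {S : A} (h : K.Lvl 9 S) (hE : K.E S = 0) :
    ∃ δ a₂ a₁ a₀ μ ν ρ : A, K.Lvl 0 δ ∧ K.Lvl 0 a₂ ∧ K.Lvl 0 a₁ ∧ K.Lvl 0 a₀ ∧ K.Lvl 0 μ ∧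
      K.Lvl 0 ν ∧ K.Lvl 0 ρ ∧ δ * K.F 5 = 0 ∧
      18 * S = 2 * δ * K.sigma + 6 * (2 * μ * K.v 0 + ρ) * K.v 5 +
        K.q * (a₂ * K.v 2 ^ 2 + 2 * a₁ * K.v 2 + a₀) + 2 * (μ * K.v 1 + ν) := by
  obtain ⟨δ, γ, α, β, hδ, hδ0, hγ, hα, hβ, hF, α0, α1, α2, β0, β2, β1, hS⟩ := solution h hE
  have l1 : ∀ {a}, K.Lvl 1 a → K.d 0 a = 0 → K.Lvl 0 a := fun h h' => h.mono h'
  have l3 : ∀ {a}, K.Lvl 3 a → K.d 0 a = 0 → K.d 1 a = 0 → K.d 2 a = 0 → K.Lvl 0 a :=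
    fun h h0 h1 h2 => ((h.mono h2).mono h1).mono h0
  have hc : ∀ i j a, K.d i a = 0 → K.d i (K.d j a) = 0 := fun i j a h => by
    rw [K.d_comm, h, map_zero]
  -- Since `2β_x = γ_t` depends on `t` only while `β_t = 0`, both sides are constant; hence `β` is
  -- affine in `x` and `γ` is affine in `t`.
  have hμ : K.Lvl 0 (K.d 1 β) := l3 (hβ.d 1) (hc _ _ _ β0)
    (eq_zero_of_ofNat_mul 2 (by
      have := congrArg (K.d 1) β1
      simpa [hγ.d 0 1] using this)) (hc _ _ _ β2)
  have h22 : K.Lvl 0 (K.d 2 (K.d 2 α)) := l3 ((hα.d 2).d 2) (hc _ _ _ (hc _ _ _ α0))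
    (hc _ _ _ (hc _ _ _ α1)) α2
  have ha1 : K.Lvl 0 (K.d 2 α - K.d 2 (K.d 2 α) * K.v 2) := by
    intro i hi
    have := h22 i hi
    by_cases h2 : i = 2
    · subst h2; simp [this, K.d_v]
    · have : K.d i (K.d 2 α) = 0 := by
        refine hc _ _ _ ?_
        rcases (show i = 0 ∨ i = 1 ∨ 3 ≤ i by omega) with rfl | rfl | h3
        · exact α0
        · exact α1
        · exact hα i h3
      simp [this, h22 i hi, K.d_v, h2]
  refine ⟨δ, K.d 2 (K.d 2 α), K.d 2 α - K.d 2 (K.d 2 α) * K.v 2,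
    2 * α - K.d 2 (K.d 2 α) * K.v 2 ^ 2 - 2 * (K.d 2 α - K.d 2 (K.d 2 α) * K.v 2) * K.v 2,
    K.d 1 β, β - K.d 1 β * K.v 1, γ - 2 * K.d 1 β * K.v 0, l1 hδ hδ0, h22, ha1, ?_, hμ, ?_, ?_, hF, ?_⟩
  · intro i hi
    simp only [map_sub, Derivation.leibniz, smul_eq_mul, ha1 i hi, h22 i hi, K.d_v,
      Derivation.leibniz_pow, derivation_ofNat]
    by_cases h2 : i = 2
    · subst h2; simp; ring
    · have : K.d i α = 0 := by
        rcases (show i = 0 ∨ i = 1 ∨ 3 ≤ i by omega) with rfl | rfl | h3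
        · exact α0
        · exact α1
        · exact hα i h3
      simp [this, h2]
  · refine l3 (fun i hi => ?_) ?_ ?_ ?_ <;>
      simp [hμ _ (Nat.zero_le _), K.d_v, β0, β2]
    simp [hβ i hi]
    omega
  · refine l1 (fun i hi => ?_) ?_ <;>
      simp [hμ _ (Nat.zero_le _), K.d_v, ← β1]
    simp [hγ i hi]
    omega
  · linear_combination 2 * hS

end Frame

/-! ### The concrete frame on a domain -/

theorem contDiffAt_iteratedDeriv {f : ℝ → ℝ} {I : Set ℝ} (hI : IsOpen I)
    (hf : ContDiffOn ℝ ∞ f I) (k : ℕ) {y : ℝ} (hy : y ∈ I) :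
    ContDiffAt ℝ ∞ (iteratedDeriv k f) y := by
  have : ContDiffOn ℝ ∞ (iteratedDeriv k f) I := by
    induction k with
    | zero => simpa using hf
    | succ k ih => rw [iteratedDeriv_succ]; exact ih.deriv_of_isOpen hI (by simp)
  exact this.contDiffAt (hI.mem_nhds hy)

/-- A domain in the space of the coordinates `t, x, u, p, η, ω₀, ω₁, …`. -/
structure Domain (f : ℝ → ℝ) where
  I : Set ℝ
  hI : IsOpen I
  hf : ContDiffOn ℝ ∞ f I
  O : Set (ℕ → ℝ)
  hO : IsOpen O
  ne : ∀ v ∈ O, v 3 ≠ 0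
  mem : ∀ v ∈ O, v 2 ∈ I

namespace Domain

variable {f : ℝ → ℝ} (M : Domain f)

/-- The coordinates. -/
abbrev c (i : ℕ) : Cyl M.O := Cyl.coord M.O i

/-- The inverse of `p`. -/
def q : Cyl M.O := Cyl.subst₁ (fun y => y⁻¹) (M.c 3) fun v => contDiffAt_inv _ (M.ne v.1 v.2)

/-- The halved derivatives of `f`. -/
def F (k : ℕ) : Cyl M.O := Cyl.subst₁ (fun y => iteratedDeriv k f y / 2) (M.c 2) fun v =>
  (contDiffAt_iteratedDeriv M.hI M.hf k (M.mem v.1 v.2)).div_const 2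

/-- The components of the total derivative in `x`. -/
def ξ : ℕ → Cyl M.O
  | 0 => 0
  | 1 => 1
  | 2 => M.c 3
  | 3 => 2 * M.c 3 * M.c 4
  | 4 => M.c 5 - M.F 0 * M.q ^ 2 + M.c 4 ^ 2
  | k + 5 => M.c (k + 6)

/-- The total derivative in `x`. -/
def X : Derivation ℝ (Cyl M.O) (Cyl M.O) := Cyl.D M.hO M.ξ

/-- The components of the total derivative in `t`. -/
def τ : ℕ → Cyl M.O
  | 0 => 1
  | 1 => 0
  | 2 => 2 * M.c 3 * M.c 5
  | 3 => M.c 3 * (4 * M.c 4 * M.c 5 + 2 * M.c 6)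
  | 4 => M.c 7 + 2 * (M.c 5 - M.F 0 * M.q ^ 2 + M.c 4 ^ 2) * M.c 5 + 2 * M.c 4 * M.c 6
  | k + 5 => M.X^[k] (M.c 8 + (6 * M.c 5 - 8 * (M.F 0 * M.q ^ 2)) * M.c 6)

/-- The total derivative in `t`. -/
def T : Derivation ℝ (Cyl M.O) (Cyl M.O) := Cyl.D M.hO M.τ

/-- The frame of functions on the domain. -/
def frame : Frame (Cyl M.O) where
  d := Cyl.pd M.hO
  X := M.X
  T := M.T
  v := M.c
  q := M.q
  F := M.F
  d_v i j := Cyl.pd_coord M.hO i j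
  d_comm i j a := Cyl.pd_comm M.hO i j a
  q_mul := by
    ext v
    exact inv_mul_cancel₀ (M.ne v.1 v.2)
  d_F i k := by
    ext v
    have h := Cyl.D_subst₁ M.hO (Pi.single i 1) (fun y => iteratedDeriv k f y / 2) (M.c 2)
      (fun v => (contDiffAt_iteratedDeriv M.hI M.hf k (M.mem v.1 v.2)).div_const 2) v
    refine Eq.trans h ?_
    have h2 := Cyl.pd_coord M.hO i 2
    rw [Cyl.pd] at h2
    rw [h2]
    split_ifs
    · simp [F, iteratedDeriv_succ]
    · simp
  X_v0 := Cyl.D_coord M.hO _ _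
  X_v1 := Cyl.D_coord M.hO _ _
  X_v2 := Cyl.D_coord M.hO _ _
  X_v3 := Cyl.D_coord M.hO _ _
  X_v4 := Cyl.D_coord M.hO _ _
  X_v5 _ := Cyl.D_coord M.hO _ _
  T_v0 := Cyl.D_coord M.hO _ _
  T_v1 := Cyl.D_coord M.hO _ _
  T_v2 := Cyl.D_coord M.hO _ _
  T_v3 := Cyl.D_coord M.hO _ _
  T_v4 := Cyl.D_coord M.hO _ _
  T_v5 _ := Cyl.D_coord M.hO _ _
  X_eq n a h := by
    rw [X, Cyl.D_eq_sum M.hO M.ξ a (Finset.range n)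
      (fun i hi => by rw [h i (by simpa using hi), mul_zero])]
    simp only [c, Cyl.D_coord]
  T_eq n a h := by
    rw [T, Cyl.D_eq_sum M.hO M.τ a (Finset.range n)
      (fun i hi => by rw [h i (by simpa using hi), mul_zero])]
    simp only [c, Cyl.D_coord]
  d_X i s hs a := by
    simp only [X, c, Cyl.D_coord] at hs ⊢
    rw [Cyl.pd_D, Cyl.D_eq_sum M.hO _ a s (fun j hj => by rw [hs j hj, zero_mul])]

theorem X_T (a : Cyl M.O) : M.X (M.T a) = M.T (M.X a) := by
  have h := Cyl.D_comm M.hO M.ξ M.τ 0 (fun i => by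
    have := M.frame.X_T_v i
    change M.X (M.T (M.c i)) = M.T (M.X (M.c i)) at this
    simp only [X, T, c, Cyl.D_coord] at this
    simp [this]) a
  rw [Cyl.D_eq_sum M.hO 0 a ∅ (by simp)] at h
  simpa [X, T] using h

/-- The nine variables of a characteristic as functions of the coordinates. -/
def Z : Fin 9 → Cyl M.O :=
  ![M.c 0, M.c 1, M.c 2, M.T (M.c 2), M.X (M.c 2), M.X (M.T (M.c 2)), M.X (M.X (M.c 2)),
    M.T (M.T (M.c 2)), M.X (M.X (M.T (M.c 2)))]

theorem T_c2 : M.T (M.c 2) = 2 * M.c 3 * M.c 5 := M.frame.T_v2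
theorem X_c2 : M.X (M.c 2) = M.c 3 := M.frame.X_v2
theorem X_c3 : M.X (M.c 3) = 2 * M.c 3 * M.c 4 := M.frame.X_v3
theorem T_c3 : M.T (M.c 3) = M.c 3 * (4 * M.c 4 * M.c 5 + 2 * M.c 6) := M.frame.T_v3
theorem X_c4 : M.X (M.c 4) = M.c 5 - M.F 0 * M.q ^ 2 + M.c 4 ^ 2 := M.frame.X_v4
theorem X_c5 : M.X (M.c 5) = M.c 6 := M.frame.X_v5'
theorem X_c6 : M.X (M.c 6) = M.c 7 := M.frame.X_v6
theorem T_c5 : M.T (M.c 5) = M.c 8 + (6 * M.c 5 - 8 * (M.F 0 * M.q ^ 2)) * M.c 6 := M.frame.T_v5'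

theorem X_X_c2 : M.X (M.X (M.c 2)) = 2 * M.c 3 * M.c 4 := by rw [X_c2, X_c3]

theorem Z_lvl (b : Fin 9) : M.frame.Lvl 9 (M.Z b) := by
  intro i hi
  have hd : ∀ j, j < 9 → M.frame.d i (M.c j) = 0 := fun j hj => by
    rw [show M.c j = M.frame.v j from rfl, M.frame.d_v, if_neg (by omega)]
  have hq : M.frame.d i M.q = 0 := by
    rw [show M.q = M.frame.q from rfl, M.frame.d_q, if_neg (by omega)]
  have hF : M.frame.d i (M.F 0) = 0 := by
    rw [show M.F 0 = M.frame.F 0 from rfl, M.frame.d_F, if_neg (by omega)]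
  fin_cases b <;> simp [Z, X_c2, T_c2, X_c3, T_c3, X_c4, X_c5, X_c6, T_c5, hd, hq, hF]

end Domain

/-! ### Change between the nine variables and the frame coordinates -/

/-- The nine variables of a characteristic as polynomials in the coordinates of the frame and
`χ = f(u) / (2 u_x²)`. -/
def zpoly (χ : ℝ) (v : ℕ → ℝ) : Fin 9 → ℝ :=
  ![v 0, v 1, v 2, 2 * v 3 * v 5, v 3, v 3 * (4 * v 4 * v 5 + 2 * v 6), 2 * v 3 * v 4,
    2 * v 3 * (4 * v 4 * v 5 + 2 * v 6) * v 5 + 2 * v 3 * (v 8 + (6 * v 5 - 8 * χ) * v 6),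
    2 * v 3 * v 4 * (4 * v 4 * v 5 + 2 * v 6) +
      v 3 * (4 * (v 5 - χ + v 4 ^ 2) * v 5 + 4 * v 4 * v 6 + 2 * v 7)]

theorem continuous_zpoly : Continuous fun x : ℝ × (ℕ → ℝ) => zpoly x.1 x.2 := by
  refine continuous_pi fun i => ?_
  fin_cases i <;> simp only [zpoly] <;> dsimp <;> fun_prop

/-- The nine variables of a characteristic in terms of the coordinates of the frame. -/
def zpt (f : ℝ → ℝ) (v : ℕ → ℝ) : Fin 9 → ℝ := zpoly (f (v 2) / 2 * (v 3)⁻¹ ^ 2) v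

/-- The coordinates of the frame as polynomials in the nine variables, the remaining coordinates,
`χ = f(u) / (2 u_x²)` and `r = 1 / u_x`. -/
def zinvPoly (χ r : ℝ) (z : Fin 9 → ℝ) (w : ℕ → ℝ) : ℕ → ℝ :=
  let η := z 6 * r / 2
  let w₀ := z 3 * r / 2
  let w₁ := (z 5 * r - 4 * η * w₀) / 2
  fun
  | 0 => z 0
  | 1 => z 1
  | 2 => z 2
  | 3 => z 4
  | 4 => η
  | 5 => w₀
  | 6 => w₁
  | 7 => (z 8 * r - 2 * η * (z 5 * r) - 4 * (w₀ - χ + η ^ 2) * w₀ - 4 * η * w₁) / 2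
  | 8 => z 7 * r / 2 - z 5 * r * w₀ - (6 * w₀ - 8 * χ) * w₁
  | k + 9 => w (k + 9)

theorem continuous_zinvPoly :
    Continuous fun x : ℝ × ℝ × (Fin 9 → ℝ) × (ℕ → ℝ) => zinvPoly x.1 x.2.1 x.2.2.1 x.2.2.2 := by
  refine continuous_pi fun i => ?_
  match i with
  | 0 => simp only [zinvPoly]; fun_prop
  | 1 => simp only [zinvPoly]; fun_prop
  | 2 => simp only [zinvPoly]; fun_prop
  | 3 => simp only [zinvPoly]; fun_prop
  | 4 => simp only [zinvPoly]; fun_prop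
  | 5 => simp only [zinvPoly]; fun_prop
  | 6 => simp only [zinvPoly]; fun_prop
  | 7 => simp only [zinvPoly]; fun_prop
  | 8 => simp only [zinvPoly]; fun_prop
  | k + 9 => simp only [zinvPoly]; fun_prop

/-- The coordinates of the frame in terms of the nine variables and the remaining coordinates. -/
def zinv (f : ℝ → ℝ) (z : Fin 9 → ℝ) (w : ℕ → ℝ) : ℕ → ℝ :=
  zinvPoly (f (z 2) / 2 * (z 4)⁻¹ ^ 2) (z 4)⁻¹ z w

theorem zpt_zinv (f : ℝ → ℝ) (z : Fin 9 → ℝ) (hz : z 4 ≠ 0) (w : ℕ → ℝ) :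
    zpt f (zinv f z w) = z := by
  funext i
  fin_cases i <;> simp [zpt, zpoly, zinv, zinvPoly] <;> field_simp <;> ring

theorem zinv_zpt (f : ℝ → ℝ) (v : ℕ → ℝ) (hv : v 3 ≠ 0) : zinv f (zpt f v) v = v := by
  funext i
  match i with
  | 0 => rfl
  | 1 => rfl
  | 2 => rfl
  | 3 => rfl
  | 4 => simp [zpt, zpoly, zinv, zinvPoly]; field_simp
  | 5 => simp [zpt, zpoly, zinv, zinvPoly]; field_simp
  | 6 => simp [zpt, zpoly, zinv, zinvPoly]; field_simp; ring
  | 7 => simp [zpt, zpoly, zinv, zinvPoly]; field_simp; ring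
  | 8 => simp [zpt, zpoly, zinv, zinvPoly]; field_simp; ring
  | k + 9 => rfl

/-- The domain lying over an open set of the space of the nine variables. -/
def domainOver {f : ℝ → ℝ} {I : Set ℝ} (hI : IsOpen I) (hf : ContDiffOn ℝ ∞ f I)
    {U : Set (Fin 9 → ℝ)} (hU : IsOpen U) (hUx : ∀ z ∈ U, z 4 ≠ 0) (hUI : ∀ z ∈ U, z 2 ∈ I) :
    Domain f where
  I := I
  hI := hI
  hf := hf
  O := {v | zpt f v ∈ U}
  hO := by
    -- `zpt f` is known to be continuous only on `W`, but its preimage of `U` lies in `W` because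
    -- `zpt` keeps `u` and `u_x`.
    let W : Set (ℕ → ℝ) := {v | v 3 ≠ 0} ∩ {v | v 2 ∈ I}
    have hW : IsOpen W := (isOpen_ne_fun (by fun_prop) (by fun_prop)).inter
      (hI.preimage (continuous_apply 2))
    have h3 : ContinuousOn (fun v : ℕ → ℝ => (v 3)⁻¹) W :=
      (continuous_apply 3).continuousOn.inv₀ fun v hv => hv.1
    have hc : ContinuousOn (fun v : ℕ → ℝ => f (v 2)) W :=
      hf.continuousOn.comp (continuous_apply 2).continuousOn fun v hv => hv.2
    have hz : ContinuousOn (zpt f) W :=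
      continuous_zpoly.comp_continuousOn
        (((hc.div_const 2).mul (h3.pow 2)).prodMk continuousOn_id)
    have e : {v | zpt f v ∈ U} = W ∩ zpt f ⁻¹' U := by
      ext v
      refine ⟨fun h => ⟨⟨hUx _ h, hUI _ h⟩, h⟩, fun h => h.2⟩
    rw [e]
    exact hz.isOpen_inter_preimage hW hU
  ne v hv := hUx _ hv
  mem v hv := hUI _ hv

section
variable {f : ℝ → ℝ} {I : Set ℝ} (hI : IsOpen I) (hf : ContDiffOn ℝ ∞ f I)
  {U : Set (Fin 9 → ℝ)} (hU : IsOpen U) (hUx : ∀ z ∈ U, z 4 ≠ 0) (hUI : ∀ z ∈ U, z 2 ∈ I)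

/-- The maps `zpt` and `zinv` show that the first nine frame coordinates can be traded for the nine
variables, while the others are free; so the domain is a continuous image of `U` times a full
product of lines. -/
theorem domainOver_preconnected (hUc : IsPreconnected U) :
    IsPreconnected (domainOver hI hf hU hUx hUI).O := by
  have e : (domainOver hI hf hU hUx hUI).O =
      (fun x : (Fin 9 → ℝ) × (ℕ → ℝ) => zinv f x.1 x.2) '' (U ×ˢ Set.univ) := by
    ext v
    constructor
    · intro hv
      exact ⟨(zpt f v, v), ⟨hv, trivial⟩, zinv_zpt f v (hUx _ hv)⟩
    · rintro ⟨⟨z, w⟩, ⟨hz, -⟩, rfl⟩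
      change zpt f (zinv f z w) ∈ U
      rw [zpt_zinv f z (hUx z hz)]
      exact hz
  rw [e]
  refine (hUc.prod isPreconnected_univ).image _ ?_
  have h4 : ContinuousOn (fun x : (Fin 9 → ℝ) × (ℕ → ℝ) => (x.1 4)⁻¹) (U ×ˢ Set.univ) :=
    ContinuousOn.inv₀ (by fun_prop) fun x hx => hUx _ hx.1
  have h2 : ContinuousOn (fun x : (Fin 9 → ℝ) × (ℕ → ℝ) => f (x.1 2)) (U ×ˢ Set.univ) :=
    hf.continuousOn.comp (by fun_prop) fun x hx => hUI _ hx.1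
  exact continuous_zinvPoly.comp_continuousOn
    (((h2.div_const 2).mul (h4.pow 2)).prodMk (h4.prodMk continuousOn_id))

end

theorem Domain.Z_apply {f : ℝ → ℝ} (M : Domain f) (b : Fin 9) (v : M.O) :
    M.Z b v = zpt f v b := by
  have hq : M.q v = (v.1 3)⁻¹ := rfl
  have hF : M.F 0 v = f (v.1 2) / 2 := by
    change iteratedDeriv 0 f (v.1 2) / 2 = _
    rw [iteratedDeriv_zero]
  fin_cases b <;>
    simp [Domain.Z, zpt, zpoly, X_c2, T_c2, X_c3, T_c3, X_c4, X_c5, X_c6, T_c5, hq, hF] <;> ring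

/-! ### The jet space -/

/-- Indices of the jet coordinates. -/
abbrev JIdx : Type := Bool ⊕ ℕ × ℕ

/-- The jet with given coordinates. -/
def toJet (w : JIdx → ℝ) : Jet := (w (.inl false), w (.inl true), fun i j => w (.inr (i, j)))

theorem exists_toJet (q : Jet) : ∃ w, toJet w = q :=
  ⟨fun k => Sum.elim (fun b => if b then q.2.1 else q.1) (fun ij => q.2.2 ij.1 ij.2) k, rfl⟩

/-- The jets lying over a set. -/
def jetsOver (U : Set (Fin 9 → ℝ)) : Set (JIdx → ℝ) := {w | mixed (toJet w) ∈ U}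

theorem isOpen_jetsOver {U : Set (Fin 9 → ℝ)} (hU : IsOpen U) : IsOpen (jetsOver U) := by
  refine hU.preimage (continuous_pi fun i => ?_)
  fin_cases i <;> exact continuous_apply _

/-- The coefficients of the total derivative in `x`. -/
def jetX (U : Set (Fin 9 → ℝ)) : JIdx → Cyl (jetsOver U)
  | .inl false => 0
  | .inl true => 1
  | .inr (i, j) => Cyl.coord _ (.inr (i, j + 1))

/-- The coefficients of the total derivative in `t`. -/
def jetT (U : Set (Fin 9 → ℝ)) : JIdx → Cyl (jetsOver U)
  | .inl false => 1
  | .inl true => 0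
  | .inr (i, j) => Cyl.coord _ (.inr (i + 1, j))

/-- The function `F` on jets is represented by `a` over `U`. -/
def Rep {U : Set (Fin 9 → ℝ)} (F : Jet → ℝ) (a : Cyl (jetsOver U)) : Prop :=
  ∀ w, F (toJet w.1) = a w

section

variable {U : Set (Fin 9 → ℝ)} (hU : IsOpen U)

/-- The total derivative in `x` on functions of jets. -/
def JX : Derivation ℝ (Cyl (jetsOver U)) (Cyl (jetsOver U)) := Cyl.D (isOpen_jetsOver hU) (jetX U)

/-- The total derivative in `t` on functions of jets. -/
def JT : Derivation ℝ (Cyl (jetsOver U)) (Cyl (jetsOver U)) := Cyl.D (isOpen_jetsOver hU) (jetT U)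

theorem lineDeriv_rep (hU : IsOpen U) {F : Jet → ℝ} {a : Cyl (jetsOver U)} (h : Rep F a) (w : jetsOver U) (x : JIdx → ℝ) :
    lineDeriv ℝ F (toJet w.1) (toJet x) = lineDeriv ℝ (Cyl.ext0 a) w.1 x := by
  unfold lineDeriv
  refine Filter.EventuallyEq.deriv_eq ?_
  filter_upwards [Cyl.line_mem (isOpen_jetsOver hU) w.2 x] with s hs
  have := h ⟨_, hs⟩
  rw [Cyl.ext0, dif_pos hs, ← this]
  rfl

theorem Rep.dx {F : Jet → ℝ} {a : Cyl (jetsOver U)} (h : Rep F a) : Rep (Dx F) (JX hU a) :=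
  fun w => lineDeriv_rep hU h w (fun i => jetX U i w)

theorem Rep.dt {F : Jet → ℝ} {a : Cyl (jetsOver U)} (h : Rep F a) : Rep (Dt F) (JT hU a) :=
  fun w => lineDeriv_rep hU h w (fun i => jetT U i w)

theorem Rep.iterate {F : Jet → ℝ} {a : Cyl (jetsOver U)} (h : Rep F a) (i j : ℕ) :
    Rep (Dt^[i] (Dx^[j] F)) ((JT hU)^[i] ((JX hU)^[j] a)) := by
  have hx : Rep (Dx^[j] F) ((JX hU)^[j] a) := by
    induction j with
    | zero => exact h
    | succ j ih => rw [Function.iterate_succ_apply', Function.iterate_succ_apply']; exact ih.dx hU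
  induction i with
  | zero => exact hx
  | succ i ih => rw [Function.iterate_succ_apply', Function.iterate_succ_apply']; exact ih.dt hU

/-- A jet coordinate. -/
def jc (U : Set (Fin 9 → ℝ)) (i j : ℕ) : Cyl (jetsOver U) := Cyl.coord _ (.inr (i, j))

theorem JX_jc (i j : ℕ) : JX hU (jc U i j) = jc U i (j + 1) := Cyl.D_coord _ _ _
theorem JT_jc (i j : ℕ) : JT hU (jc U i j) = jc U (i + 1) j := Cyl.D_coord _ _ _

theorem JX_JT (a : Cyl (jetsOver U)) : JX hU (JT hU a) = JT hU (JX hU a) := by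
  have h := Cyl.D_comm (isOpen_jetsOver hU) (jetX U) (jetT U) 0 (fun i => by
    rcases i with (_ | _) | ⟨i, j⟩
    · simp [jetX, jetT]
    · simp [jetX, jetT]
    · simp [jetX, jetT, Cyl.D_coord]) a
  classical
  rw [Cyl.D_eq_sum (isOpen_jetsOver hU) 0 a ∅ (by simp)] at h
  simpa [JX, JT] using h

variable {f : ℝ → ℝ} {I : Set ℝ} (hI : IsOpen I) (hf : ContDiffOn ℝ ∞ f I)
  (hUx : ∀ z ∈ U, z 4 ≠ 0) (hUI : ∀ z ∈ U, z 2 ∈ I)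

/-- The inverse of `u_x`. -/
def jq : Cyl (jetsOver U) := Cyl.subst₁ (fun y => y⁻¹) (jc U 0 1) fun v => contDiffAt_inv _ (hUx _ v.2)

/-- The derivatives of `f`. -/
def jF (k : ℕ) : Cyl (jetsOver U) := Cyl.subst₁ (iteratedDeriv k f) (jc U 0 0) fun v =>
  contDiffAt_iteratedDeriv hI hf k (hUI _ v.2)

theorem jq_mul : jq hUx * jc U 0 1 = 1 := by
  ext v
  exact inv_mul_cancel₀ (hUx _ v.2)

theorem JX_jF (k : ℕ) : JX hU (jF hI hf hUI k) = jF hI hf hUI (k + 1) * jc U 0 1 := by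
  ext v
  refine (Cyl.D_subst₁ _ _ _ _ _ _).trans ?_
  change deriv (iteratedDeriv k f) _ * JX hU (jc U 0 0) v = _
  rw [JX_jc, ← iteratedDeriv_succ]
  rfl

theorem JT_jF (k : ℕ) : JT hU (jF hI hf hUI k) = jF hI hf hUI (k + 1) * jc U 1 0 := by
  ext v
  refine (Cyl.D_subst₁ _ _ _ _ _ _).trans ?_
  change deriv (iteratedDeriv k f) _ * JT hU (jc U 0 0) v = _
  rw [JT_jc, ← iteratedDeriv_succ]
  rfl

/-- The equation as a function on jets. -/
def jK : Cyl (jetsOver U) := jc U 1 0 - jc U 0 3 + (3 / 2 : ℝ) • (jc U 0 2 ^ 2 * jq hUx) -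
  jF hI hf hUI 0 * jq hUx

theorem rep_gKN : Rep (gKN f) (jK hI hf hUx hUI) := by
  intro w
  simp [gKN, jK, jc, jF, jq, u, toJet, div_eq_mul_inv]

theorem rep_symmDet {P : Jet → ℝ} {a : Cyl (jetsOver U)} (h : Rep P a) :
    Rep (symmDet f P) (JT hU a - JX hU (JX hU (JX hU a))
      + (3 : ℝ) • (jc U 0 2 * jq hUx * JX hU (JX hU a))
      - (3 / 2 : ℝ) • (jc U 0 2 ^ 2 * jq hUx ^ 2 * JX hU a)
      + jF hI hf hUI 0 * jq hUx ^ 2 * JX hU a - jF hI hf hUI 1 * jq hUx * a) := by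
  intro w
  have h1 := h.dx hU
  have h2 := h1.dx hU
  have h3 := h2.dx hU
  have ht := h.dt hU
  have e : ∀ Q : Jet → ℝ, Dx^[3] Q = Dx (Dx (Dx Q)) := fun _ => rfl
  have e2 : ∀ Q : Jet → ℝ, Dx^[2] Q = Dx (Dx Q) := fun _ => rfl
  rw [symmDet, e, e2, h w, h1 w, h2 w, h3 w, ht w]
  simp [jc, jF, jq, u, toJet, div_eq_mul_inv]
  ring

/-- A characteristic as a function on jets. -/
def jP {P : (Fin 9 → ℝ) → ℝ} (hP : ContDiffOn ℝ ∞ P U) : Cyl (jetsOver U) :=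
  Cyl.subst P ![Cyl.coord _ (.inl false), Cyl.coord _ (.inl true), jc U 0 0, jc U 1 0, jc U 0 1,
    jc U 1 1, jc U 0 2, jc U 2 0, jc U 1 2] fun v => by
    have e : (fun b => (![Cyl.coord _ (.inl false), Cyl.coord _ (.inl true), jc U 0 0, jc U 1 0,
      jc U 0 1, jc U 1 1, jc U 0 2, jc U 2 0, jc U 1 2] : Fin 9 → Cyl (jetsOver U)) b v) =
        mixed (toJet v.1) := by
      funext b; fin_cases b <;> rfl
    rw [e]
    exact hP.contDiffAt (hU.mem_nhds v.2)

theorem jP_apply {P : (Fin 9 → ℝ) → ℝ} (hP : ContDiffOn ℝ ∞ P U) (v : jetsOver U) :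
    jP hU hP v = P (mixed (toJet v.1)) := by
  refine congrArg P ?_
  funext b; fin_cases b <;> rfl

theorem rep_jP {P : (Fin 9 → ℝ) → ℝ} (hP : ContDiffOn ℝ ∞ P U) :
    Rep (fun q => P (mixed q)) (jP hU hP) := fun w => (jP_apply hU hP w).symm

/-! ### The parametrization of solution jets -/

/-- The jet coordinates of solutions in the frame. -/
def psi (M : Domain f) : JIdx → Cyl M.O
  | .inl false => M.c 0
  | .inl true => M.c 1
  | .inr (i, j) => M.X^[j] (M.T^[i] (M.c 2))

/-- The domain of the frame lying over `U`. -/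
abbrev dom : Domain f := domainOver hI hf hU hUx hUI

theorem mixed_psi (v : (dom hU hI hf hUx hUI).O) :
    mixed (toJet fun k => psi (dom hU hI hf hUx hUI) k v) = zpt f v.1 := by
  funext b
  rw [← Domain.Z_apply]
  fin_cases b <;> rfl

theorem psi_mem (v : (dom hU hI hf hUx hUI).O) :
    (fun k => psi (dom hU hI hf hUx hUI) k v) ∈ jetsOver U := by
  change mixed _ ∈ U
  rw [mixed_psi]
  exact v.2

/-- Restriction of functions on jets to solutions. -/
def res (a : Cyl (jetsOver U)) : Cyl (dom hU hI hf hUx hUI).O :=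
  Cyl.pull (psi _) (psi_mem hU hI hf hUx hUI) a

theorem res_JX (a : Cyl (jetsOver U)) :
    (dom hU hI hf hUx hUI).X (res hU hI hf hUx hUI a) = res hU hI hf hUx hUI (JX hU a) := by
  refine Cyl.D_pull _ _ _ _ _ _ (fun i => ?_) a
  rcases i with (_ | _) | ⟨i, j⟩
  · exact (Domain.frame _).X_v0
  · exact (Domain.frame _).X_v1
  · exact (Function.iterate_succ_apply' _ _ _).symm

theorem X_iterate_T {f : ℝ → ℝ} (M : Domain f) (j : ℕ) (a : Cyl M.O) :
    M.X^[j] (M.T a) = M.T (M.X^[j] a) := by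
  induction j with
  | zero => rfl
  | succ j ih => rw [Function.iterate_succ_apply', ih, Function.iterate_succ_apply', M.X_T]

theorem res_JT (a : Cyl (jetsOver U)) :
    (dom hU hI hf hUx hUI).T (res hU hI hf hUx hUI a) = res hU hI hf hUx hUI (JT hU a) := by
  refine Cyl.D_pull _ _ _ _ _ _ (fun i => ?_) a
  rcases i with (_ | _) | ⟨i, j⟩
  · exact (Domain.frame _).T_v0
  · exact (Domain.frame _).T_v1
  · exact (X_iterate_T (dom hU hI hf hUx hUI) j _).symm.trans
      (congrArg _ (Function.iterate_succ_apply' _ _ _).symm)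

theorem psi_ut (M : Domain f) (v : M.O) : psi M (.inr (1, 0)) v = 2 * v.1 3 * v.1 5 := by
  change M.T (M.c 2) v = _
  rw [M.T_c2]; rfl

theorem psi_ux (M : Domain f) (v : M.O) : psi M (.inr (0, 1)) v = v.1 3 := by
  change M.X (M.c 2) v = _
  rw [M.X_c2]; rfl

theorem psi_uxx (M : Domain f) (v : M.O) : psi M (.inr (0, 2)) v = 2 * v.1 3 * v.1 4 := by
  change M.X (M.X (M.c 2)) v = _
  rw [M.X_X_c2]; rfl

theorem psi_uxxx (M : Domain f) (v : M.O) : psi M (.inr (0, 3)) v = 4 * v.1 3 * v.1 4 ^ 2 +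
    2 * v.1 3 * (v.1 5 - f (v.1 2) / 2 * (v.1 3)⁻¹ ^ 2 + v.1 4 ^ 2) := by
  have hq : M.q v = (v.1 3)⁻¹ := rfl
  have hF : M.F 0 v = f (v.1 2) / 2 := by
    change iteratedDeriv 0 f (v.1 2) / 2 = _
    rw [iteratedDeriv_zero]
  change M.X (M.X (M.X (M.c 2))) v = _
  rw [M.X_X_c2]
  simp [M.X_c3, M.X_c4, hq, hF]
  ring

/-- This is the Riccati relation for `η` rewritten as the equation itself. Since `res` intertwines
the total derivatives, all differential consequences vanish with it. -/
theorem res_jK : res hU hI hf hUx hUI (jK hI hf hUx hUI) = 0 := by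
  ext v
  have h3 : v.1 3 ≠ 0 := (dom hU hI hf hUx hUI).ne _ v.2
  simp only [res, Cyl.pull_apply, jK, jc, jF, jq, Cyl.add_apply, Cyl.sub_apply, Cyl.mul_apply,
    Cyl.pow_apply, Cyl.smul_apply, Cyl.subst₁_apply, Cyl.coord_apply, psi_ut, psi_ux, psi_uxx, psi_uxxx,
    iteratedDeriv_zero, Cyl.zero_apply]
  have h00 : psi (dom hU hI hf hUx hUI) (.inr (0, 0)) v = v.1 2 := rfl
  rw [h00]
  field_simp
  ring

theorem onSolutions_psi (v : (dom hU hI hf hUx hUI).O) :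
    OnSolutions f (toJet fun k => psi (dom hU hI hf hUx hUI) k v) := by
  have hm := psi_mem hU hI hf hUx hUI v
  refine ⟨hUx _ hm, fun i j => ?_⟩
  rw [(rep_gKN hI hf hUx hUI).iterate hU i j ⟨_, hm⟩]
  have h : res hU hI hf hUx hUI ((JT hU)^[i] ((JX hU)^[j] (jK hI hf hUx hUI))) = 0 := by
    have hx : res hU hI hf hUx hUI ((JX hU)^[j] (jK hI hf hUx hUI)) = 0 := by
      induction j with
      | zero => exact res_jK hU hI hf hUx hUI
      | succ j ih => rw [Function.iterate_succ_apply', ← res_JX, ih, map_zero]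
    induction i with
    | zero => exact hx
    | succ i ih => rw [Function.iterate_succ_apply', ← res_JT, ih, map_zero]
  exact congrArg (fun a : Cyl _ => a v) h

/-- A characteristic divided by `u_x` solves the determining equation in the frame. -/
theorem frame_solution {P : (Fin 9 → ℝ) → ℝ} (hP : IsSymmChar f U P) :
    ∃ S : Cyl (dom hU hI hf hUx hUI).O, (Domain.frame _).Lvl 9 S ∧ (Domain.frame _).E S = 0 ∧
      ∀ v, P (zpt f v.1) = v.1 3 * S v := by
  obtain ⟨hs, hP⟩ := hP
  set M := dom hU hI hf hUx hUI with hM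
  set Q : Cyl M.O := res hU hI hf hUx hUI (jP hU hs) with hQ
  have hQv : ∀ v, Q v = P (zpt f v.1) := fun v => by
    rw [← mixed_psi hU hI hf hUx hUI v]
    exact jP_apply hU hs _
  have hZ : ∀ v : M.O, (fun b => M.Z b v) = zpt f v.1 := fun v => funext fun b => M.Z_apply b v
  have hQ9 : M.frame.Lvl 9 Q := by
    have hsm : ∀ v : M.O, ContDiffAt ℝ ∞ P (fun b => M.Z b v) := fun v => by
      rw [hZ]; exact hs.contDiffAt (hU.mem_nhds v.2)
    have e : Q = Cyl.subst P M.Z hsm := by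
      ext v; rw [hQv, Cyl.subst_apply, hZ]
    intro i hi
    ext v
    rw [e]
    refine (Cyl.D_subst M.hO _ P M.Z hsm v).trans ?_
    refine Finset.sum_eq_zero fun b _ => ?_
    have := congrArg (fun a : Cyl M.O => a v) (M.Z_lvl b i hi)
    change Cyl.D M.hO (Pi.single i 1) (M.Z b) v = 0 at this
    rw [this, zero_mul]
  have hdet : M.T Q - M.X (M.X (M.X Q)) + 6 * M.c 4 * M.X (M.X Q) - 6 * M.c 4 ^ 2 * M.X Q
      + 2 * M.frame.chi * M.X Q - 2 * M.frame.psi * Q = 0 := by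
    ext v
    have h1 := hP _ (psi_mem hU hI hf hUx hUI v) (onSolutions_psi hU hI hf hUx hUI v)
    rw [rep_symmDet hU hI hf hUx hUI (rep_jP hU hs) ⟨_, psi_mem hU hI hf hUx hUI v⟩] at h1
    have hr : ∀ a : Cyl (jetsOver U), a ⟨_, psi_mem hU hI hf hUx hUI v⟩ = res hU hI hf hUx hUI a v :=
      fun a => rfl
    have h01 : jc U 0 1 ⟨_, psi_mem hU hI hf hUx hUI v⟩ = v.1 3 :=
      psi_ux M v
    have h02 : jc U 0 2 ⟨_, psi_mem hU hI hf hUx hUI v⟩ = 2 * v.1 3 * v.1 4 :=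
      psi_uxx M v
    have hq : jq hUx ⟨_, psi_mem hU hI hf hUx hUI v⟩ = (v.1 3)⁻¹ := by
      rw [← h01]; rfl
    have hF : ∀ k, jF hI hf hUI k ⟨_, psi_mem hU hI hf hUx hUI v⟩ = 2 * M.F k v := fun k => by
      change iteratedDeriv k f (v.1 2) = 2 * (iteratedDeriv k f (v.1 2) / 2)
      ring
    have hMq : M.q v = (v.1 3)⁻¹ := rfl
    have hn : v.1 3 ≠ 0 := M.ne _ v.2
    simp only [Cyl.add_apply, Cyl.sub_apply, Cyl.mul_apply, Cyl.smul_apply, Cyl.pow_apply, hq, hF,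
      h02] at h1
    simp only [hr, ← res_JX, ← res_JT] at h1
    simp only [Cyl.add_apply, Cyl.sub_apply, Cyl.mul_apply, Cyl.pow_apply, Cyl.ofNat_apply,
      Cyl.coord_apply, Cyl.zero_apply, Frame.chi, Frame.psi]
    change _ + 2 * (M.F 0 v * M.q v ^ 2) * _ - 2 * (M.q v * M.F 1 v) * _ = _
    rw [hMq, ← h1]
    field_simp
    ring
  -- `S = Q/u_x`; by `determining_mul` the determining expression of `Q` is `p · E S`, and `p` is
  -- invertible.
  refine ⟨M.q * Q, fun i hi => ?_, ?_, fun v => ?_⟩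
  · have hq : M.frame.d i M.q = 0 := by
      rw [show M.q = M.frame.q from rfl, M.frame.d_q, if_neg (by omega)]
    simp [hQ9 i hi, hq]
  · have hq : M.q * M.c 3 = 1 := M.frame.q_mul
    have e : M.c 3 * (M.q * Q) = Q := by linear_combination Q * hq
    have := determining_mul M.X M.T (p := M.c 3) (η := M.c 4) (w := M.c 5) (χ := M.frame.chi)
      (ψ := M.frame.psi) M.X_c3 M.frame.X_v4' M.frame.X_chi (by rw [M.X_c5]; exact M.T_c3) (M.q * Q)
    rw [e, hdet] at this
    have h2 : M.frame.E (M.q * Q) = M.T (M.q * Q) - M.X (M.X (M.X (M.q * Q))) -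
      (6 * M.c 5 - 8 * M.frame.chi) * M.X (M.q * Q) := rfl
    rw [h2]
    linear_combination -M.q * this - (M.T (M.q * Q) - M.X (M.X (M.X (M.q * Q))) -
      (6 * M.c 5 - 8 * M.frame.chi) * M.X (M.q * Q)) * hq
  · rw [Cyl.mul_apply, hQv]
    have hn : v.1 3 ≠ 0 := M.ne _ v.2
    change _ = v.1 3 * ((v.1 3)⁻¹ * _)
    field_simp

end

/-! ### The explicit characteristic -/

/-- The determining equation of the explicit characteristic in a differential ring in which the
equation holds. -/
theorem determining_knChar {B : Type} [CommRing B] [Algebra ℝ B] (X T : Derivation ℝ B B)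
    (hXT : ∀ a, X (T a) = T (X a)) {e : ℕ → ℕ → B} {q κ : B} {G : ℕ → B}
    (hX : ∀ i j, X (e i j) = e i (j + 1)) (hT : ∀ i j, T (e i j) = e (i + 1) j)
    (hq : q * e 0 1 = 1) (hκ : 2 * κ = 1) (hXκ : X κ = 0) (hTκ : T κ = 0)
    (hXG : ∀ k, X (G k) = G (k + 1) * e 0 1) (hTG : ∀ k, T (G k) = G (k + 1) * e 1 0)
    (hK : e 1 0 - e 0 3 + 3 * κ * (e 0 2 ^ 2 * q) - G 0 * q = 0) {N : B}
    (hN : N = 9 * e 1 2 - 18 * e 1 1 * e 0 2 * q + 9 * κ * e 1 0 * e 0 2 ^ 2 * q ^ 2 +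
      9 * κ * e 1 0 ^ 2 * q - 12 * e 0 2 ^ 2 * G 0 * q ^ 3 + 12 * e 0 2 * G 1 * q -
      15 * e 1 0 * G 0 * q ^ 2 + 8 * G 0 ^ 2 * q ^ 3 - 4 * e 0 1 * G 2) :
    T N - X (X (X N)) + 3 * (e 0 2 * q * X (X N)) - 3 * κ * (e 0 2 ^ 2 * q ^ 2 * X N) +
      G 0 * q ^ 2 * X N - G 1 * q * N = 4 * G 5 * e 0 1 ^ 4 := by
  have hXq : X q = - (q ^ 2 * e 0 2) := by
    have h := congrArg X hq
    simp only [Derivation.leibniz, hX, smul_eq_mul, Derivation.map_one_eq_zero] at h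
    linear_combination q * h - X q * hq
  have hTq : T q = - (q ^ 2 * e 1 1) := by
    have h := congrArg T hq
    simp only [Derivation.leibniz, hT, smul_eq_mul, Derivation.map_one_eq_zero] at h
    linear_combination q * h - T q * hq
  set p := e 0 1 with hp_def
  obtain ⟨η, hη_def⟩ : ∃ η, η = κ * e 0 2 * q := ⟨_, rfl⟩
  obtain ⟨w, hw_def⟩ : ∃ w, w = κ * e 1 0 * q := ⟨_, rfl⟩
  obtain ⟨χ, hχ_def⟩ : ∃ χ, χ = κ * G 0 * q ^ 2 := ⟨_, rfl⟩
  obtain ⟨ψ, hψ_def⟩ : ∃ ψ, ψ = κ * G 1 * q := ⟨_, rfl⟩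
  have hp : X p = 2 * p * η := by
    rw [hp_def, hX, hη_def, ← hp_def]
    linear_combination -e 0 2 * (q * p * hκ + hq)
  have hη : X η = w - χ + η ^ 2 := by
    rw [hη_def, hw_def, hχ_def]
    simp [hXκ, hXq, hX]
    linear_combination -κ * q * hK + κ * e 0 2 ^ 2 * q ^ 2 * hκ
  have hχ : X χ = ψ - 4 * η * χ := by
    rw [hχ_def, hψ_def, hη_def]
    simp [hXκ, hXq, hXG]
    linear_combination κ * G 1 * q * hq + 2 * κ * e 0 2 * G 0 * q ^ 3 * hκ
  have hψ : X ψ = κ * G 2 - 2 * η * ψ := by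
    rw [hψ_def, hη_def]
    simp [hXκ, hXq, hXG]
    linear_combination κ * G 2 * hq + κ * e 0 2 * q ^ 2 * G 1 * hκ
  have hF : ∀ k, X (κ * G k) = p * (κ * G (k + 1)) := fun k => by
    simp [hXκ, hXG]; ring
  have hXw : X w = κ * (e 1 1 * q - e 1 0 * q ^ 2 * e 0 2) := by
    rw [hw_def]; simp [hXκ, hXq, hX]; ring
  have tp' : 4 * η * w + 2 * X w = q * e 1 1 := by
    rw [hXw, hη_def, hw_def]
    linear_combination (q * e 1 1 + 2 * κ * e 0 2 * e 1 0 * q ^ 2) * hκ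
  have tp : T p = p * (4 * η * w + 2 * X w) := by
    rw [tp', hp_def, hT]
    linear_combination -e 1 1 * hq
  -- The flow of `η` is forced by `X T p = T X p` after division by `2p`; in the same way the flow
  -- of `w` below comes from `X T η = T X η`.
  have tη : T η = X (X w) + 2 * (w - χ + η ^ 2) * w + 2 * η * X w := by
    have h := hXT p
    rw [tp, hp] at h
    simp [hp, hη, tp] at h
    linear_combination -κ * q * h + (X (X w) + 2 * (w - χ + η ^ 2) * w + 2 * η * X w - T η) *
      (q * p * hκ + hq)
  have tχ : T χ = 2 * w * ψ - 2 * (4 * η * w + 2 * X w) * χ := by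
    rw [tp', hχ_def, hw_def, hψ_def]
    simp [hTκ, hTq, hTG]
    linear_combination -κ * G 1 * e 1 0 * q ^ 2 * hκ
  have tψ : T ψ = 2 * w * (κ * G 2) - (4 * η * w + 2 * X w) * ψ := by
    rw [tp', hw_def, hψ_def]
    simp [hTκ, hTq, hTG]
    linear_combination -κ * G 2 * e 1 0 * q * hκ
  have t₂ : T (κ * G 2) = 2 * p * w * (κ * G 3) := by
    rw [hw_def]
    simp [hTκ, hTG]
    linear_combination -κ * G 3 * e 1 0 * (q * p * hκ + hq)
  have tw : T w = X (X (X w)) + (6 * w - 8 * χ) * X w := by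
    have h := hXT η
    rw [tη, hη] at h
    simp [hη, hχ, tη, tχ] at h
    linear_combination -h
  have tw₂ : T (X (X w)) = X (X (T w)) := by rw [← hXT, ← hXT]
  obtain ⟨σ, hσ⟩ : ∃ σ, σ = 9 * X (X w) + 27 * w ^ 2 - 48 * χ * w - 48 * η ^ 2 * χ +
      24 * η * ψ + 16 * χ ^ 2 - 4 * (κ * G 2) := ⟨_, rfl⟩
  have hE := determining_sigma X T hp hη hχ hψ (hF 2) (hF 3) (hF 4) tη tw tw₂ tχ tψ t₂ hσ
  have hM := determining_mul X T hp hη hχ tp (2 * σ)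
  have hNσ : p * (2 * σ) = N := by
    have hXXw : X (X w) = κ * (e 1 2 * q - 2 * e 1 1 * q ^ 2 * e 0 2 - e 1 0 * q ^ 2 * e 0 3 +
        2 * e 1 0 * q ^ 3 * e 0 2 ^ 2) := by
      rw [hXw]; simp [hXκ, hXq, hX]; ring
    rw [hN, hσ, hXXw, hη_def, hw_def, hχ_def, hψ_def]
    clear * - hq hκ hK
    generalize e 0 2 = a at *
    generalize e 1 0 = b at *
    generalize e 1 1 = c at *
    generalize e 1 2 = d at *
    generalize e 0 3 = g at *
    generalize G 0 = f0 at *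
    generalize G 1 = f1 at *
    generalize G 2 = f2 at *
    grind
  rw [hNσ] at hM
  simp only [Derivation.leibniz, smul_eq_mul, derivation_ofNat, mul_zero, add_zero] at hM
  have c1 : 6 * η = 3 * (e 0 2 * q) := by rw [hη_def]; linear_combination 3 * e 0 2 * q * hκ
  have c2 : 6 * η ^ 2 = 3 * κ * (e 0 2 ^ 2 * q ^ 2) := by
    rw [hη_def]; linear_combination 3 * κ * e 0 2 ^ 2 * q ^ 2 * hκ
  have c3 : 2 * χ = G 0 * q ^ 2 := by rw [hχ_def]; linear_combination G 0 * q ^ 2 * hκ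
  have c4 : 2 * ψ = G 1 * q := by rw [hψ_def]; linear_combination G 1 * q * hκ
  linear_combination hM + 2 * p * hE - X (X N) * c1 + X N * c2 - X N * c3 + N * c4 +
    4 * G 5 * p ^ 4 * hκ

section

variable {U : Set (Fin 9 → ℝ)} (hU : IsOpen U) {f : ℝ → ℝ} {I : Set ℝ} (hI : IsOpen I)
  (hf : ContDiffOn ℝ ∞ f I) (hUx : ∀ z ∈ U, z 4 ≠ 0) (hUI : ∀ z ∈ U, z 2 ∈ I)

/-- The ideal of differential consequences of the equation. -/
def eqIdeal : Ideal (Cyl (jetsOver U)) :=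
  Ideal.span {b | ∃ i j, b = (JT hU)^[i] ((JX hU)^[j] (jK hI hf hUx hUI))}

theorem JX_iterate_JT (i : ℕ) (a : Cyl (jetsOver U)) :
    JX hU ((JT hU)^[i] a) = (JT hU)^[i] (JX hU a) := by
  induction i with
  | zero => rfl
  | succ i ih =>
    rw [Function.iterate_succ_apply', JX_JT, ih]
    exact (Function.iterate_succ_apply' _ _ _).symm

theorem derivation_span_mem {A : Type} [CommRing A] [Algebra ℝ A] (D : Derivation ℝ A A)
    {s : Set A} (h : ∀ a ∈ s, D a ∈ Ideal.span s) {a : A} (ha : a ∈ Ideal.span s) :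
    D a ∈ Ideal.span s := by
  refine Submodule.span_induction (p := fun a _ => D a ∈ Ideal.span s) (fun a ha => h a ha)
    (by simp) (fun a b _ _ ha hb => by rw [map_add]; exact add_mem ha hb)
    (fun r a ha h => ?_) ha
  rw [smul_eq_mul, D.leibniz]
  exact add_mem (Ideal.mul_mem_left _ _ h) (Ideal.mul_mem_right _ _ ha)

theorem JX_mem {a : Cyl (jetsOver U)} (ha : a ∈ eqIdeal hU hI hf hUx hUI) :
    JX hU a ∈ eqIdeal hU hI hf hUx hUI := by
  refine derivation_span_mem (JX hU) ?_ ha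
  rintro _ ⟨i, j, rfl⟩
  refine Ideal.subset_span ⟨i, j + 1, ?_⟩
  rw [JX_iterate_JT, Function.iterate_succ_apply']

theorem JT_mem {a : Cyl (jetsOver U)} (ha : a ∈ eqIdeal hU hI hf hUx hUI) :
    JT hU a ∈ eqIdeal hU hI hf hUx hUI := by
  refine derivation_span_mem (JT hU) ?_ ha
  rintro _ ⟨i, j, rfl⟩
  exact Ideal.subset_span ⟨i + 1, j, (Function.iterate_succ_apply' _ _ _).symm⟩

theorem eval_eq_zero {a : Cyl (jetsOver U)} (ha : a ∈ eqIdeal hU hI hf hUx hUI) (w : jetsOver U)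
    (hw : OnSolutions f (toJet w.1)) : a w = 0 := by
  refine Submodule.span_induction (p := fun a _ => a w = 0) ?_ rfl
    (fun a b _ _ ha hb => by rw [Cyl.add_apply, ha, hb, add_zero])
    (fun r a _ h => by rw [smul_eq_mul, Cyl.mul_apply, h, mul_zero]) ha
  rintro _ ⟨i, j, rfl⟩
  rw [← (rep_gKN hI hf hUx hUI).iterate hU i j w]
  exact hw.2 i j

include hI hf hUx hUI in
theorem contDiffOn_knChar : ContDiffOn ℝ ∞ (knChar f) U := by
  intro z hz
  refine ContDiffAt.contDiffWithinAt ?_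
  have h2 : ContDiffAt ℝ ∞ (fun z : Fin 9 → ℝ => z 2) z := by fun_prop
  have hd : ∀ k, ContDiffAt ℝ ∞ (fun z : Fin 9 → ℝ => iteratedDeriv k f (z 2)) z := fun k =>
    ContDiffAt.comp z (contDiffAt_iteratedDeriv hI hf k (hUI z hz)) h2
  have h0 := hd 0
  have h1 := hd 1
  have h2 := hd 2
  rw [iteratedDeriv_zero] at h0
  rw [iteratedDeriv_one] at h1
  rw [iteratedDeriv_succ, iteratedDeriv_one] at h2
  have hi : ContDiffAt ℝ ∞ (fun z : Fin 9 → ℝ => (z 4)⁻¹) z :=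
    ContDiffAt.inv (by fun_prop) (hUx z hz)
  have key : ∀ a b c r : (Fin 9 → ℝ) → ℝ, ContDiffAt ℝ ∞ a z → ContDiffAt ℝ ∞ b z →
      ContDiffAt ℝ ∞ c z → ContDiffAt ℝ ∞ r z → ContDiffAt ℝ ∞ (fun z => z 8 -
        2 * (z 5 * z 6 * r z) + 1 / 2 * (z 3 * z 6 ^ 2 * r z ^ 2) + 1 / 2 * (z 3 ^ 2 * r z) -
        4 / 3 * (z 6 ^ 2 * a z * r z ^ 3) + 4 / 3 * (z 6 * b z * r z) -
        5 / 3 * (z 3 * a z * r z ^ 2) + 8 / 9 * (a z ^ 2 * r z ^ 3) - 4 / 9 * (z 4 * c z)) z := by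
    intro a b c r ha hb hc hr
    fun_prop
  refine (key _ _ _ _ h0 h1 h2 hi).congr_of_eventuallyEq (.of_forall fun z => ?_)
  simp only [knChar, div_eq_mul_inv, inv_pow]

include hU hI hf hUx hUI in
/-- On solutions the determining equation of the explicit characteristic reduces to `f⁽⁵⁾`. -/
theorem symmDet_knChar (w : jetsOver U) (hw : OnSolutions f (toJet w.1)) :
    symmDet f (fun q => knChar f (mixed q)) (toJet w.1) =
      4 / 9 * iteratedDeriv 5 f (w.1 (.inr (0, 0))) * w.1 (.inr (0, 1)) ^ 4 := by
  have hs := contDiffOn_knChar hI hf hUx hUI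
  rw [rep_symmDet hU hI hf hUx hUI (rep_jP hU hs) w]
  -- Modulo `J` the equation holds identically and both total derivatives descend, so the algebraic
  -- identity applies. Evaluation at a solution jet annihilates `J` and brings the result back.
  set J := eqIdeal hU hI hf hUx hUI
  let mk := Ideal.Quotient.mkₐ ℝ J
  have hmk : Function.Surjective mk := Ideal.Quotient.mkₐ_surjective ℝ J
  have h0 : ∀ a, mk a = 0 ↔ a ∈ J := fun a => Ideal.Quotient.eq_zero_iff_mem
  let X := Derivation.liftOfSurjective hmk (d := JX hU)
    (fun a ha => (h0 _).2 (JX_mem hU hI hf hUx hUI ((h0 a).1 ha)))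
  let T := Derivation.liftOfSurjective hmk (d := JT hU)
    (fun a ha => (h0 _).2 (JT_mem hU hI hf hUx hUI ((h0 a).1 ha)))
  have hX : ∀ a, X (mk a) = mk (JX hU a) := fun a => Derivation.liftOfSurjective_apply hmk _ a
  have hT : ∀ a, T (mk a) = mk (JT hU a) := fun a => Derivation.liftOfSurjective_apply hmk _ a
  -- One half as a ring element: the real scalars become polynomial expressions over a commutative
  -- ring.
  let κ : Cyl (jetsOver U) := algebraMap ℝ _ (1 / 2)
  have hκ : 2 * κ = 1 := by
    have : (2 : Cyl (jetsOver U)) = algebraMap ℝ _ 2 := (map_ofNat _ 2).symm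
    rw [this, ← map_mul]; norm_num
  have hsm : ∀ a : Cyl (jetsOver U), (3 / 2 : ℝ) • a = 3 * κ * a := fun a => by
    rw [Algebra.smul_def, show (3 / 2 : ℝ) = 3 * (1 / 2) by norm_num, map_mul, map_ofNat]
  have hsm3 : ∀ a : Cyl (jetsOver U), (3 : ℝ) • a = 3 * a := fun a => by
    rw [Algebra.smul_def, map_ofNat]
  have hN : 9 * jP hU hs = 9 * jc U 1 2 - 18 * jc U 1 1 * jc U 0 2 * jq hUx +
      9 * κ * jc U 1 0 * jc U 0 2 ^ 2 * jq hUx ^ 2 + 9 * κ * jc U 1 0 ^ 2 * jq hUx -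
      12 * jc U 0 2 ^ 2 * jF hI hf hUI 0 * jq hUx ^ 3 + 12 * jc U 0 2 * jF hI hf hUI 1 * jq hUx -
      15 * jc U 1 0 * jF hI hf hUI 0 * jq hUx ^ 2 + 8 * jF hI hf hUI 0 ^ 2 * jq hUx ^ 3 -
      4 * jc U 0 1 * jF hI hf hUI 2 := by
    ext v
    have hκv : κ v = 1 / 2 := rfl
    have hF2 : jF hI hf hUI 2 v = deriv (deriv f) (v.1 (.inr (0, 0))) := by
      change iteratedDeriv 2 f _ = _
      rw [iteratedDeriv_succ, iteratedDeriv_one]; rfl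
    have hF1 : jF hI hf hUI 1 v = deriv f (v.1 (.inr (0, 0))) := by
      change iteratedDeriv 1 f _ = _
      rw [iteratedDeriv_one]; rfl
    have hF0 : jF hI hf hUI 0 v = f (v.1 (.inr (0, 0))) := by
      change iteratedDeriv 0 f _ = _
      rw [iteratedDeriv_zero]; rfl
    have hq : jq hUx v = (v.1 (.inr (0, 1)))⁻¹ := rfl
    simp only [Cyl.add_apply, Cyl.sub_apply, Cyl.mul_apply, Cyl.pow_apply, Cyl.ofNat_apply,
      jP_apply, hκv, hF0, hF1, hF2, hq, jc, Cyl.coord_apply]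
    simp [knChar, mixed, u, toJet]
    ring
  have key := determining_knChar X T (fun a => by
      obtain ⟨a, rfl⟩ := hmk a
      rw [hT, hX, hX, hT, JX_JT])
    (e := fun i j => mk (jc U i j)) (q := mk (jq hUx)) (κ := mk κ)
    (G := fun k => mk (jF hI hf hUI k)) (fun i j => by rw [hX, JX_jc]) (fun i j => by rw [hT, JT_jc])
    (by rw [← map_mul, jq_mul, map_one])
    (by rw [← map_ofNat mk, ← map_mul, hκ, map_one])
    (by rw [hX, Derivation.map_algebraMap, map_zero])
    (by rw [hT, Derivation.map_algebraMap, map_zero])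
    (fun k => by rw [hX, JX_jF, map_mul]) (fun k => by rw [hT, JT_jF, map_mul])
    (by
      have : mk (jK hI hf hUx hUI) = 0 := (h0 _).2 (Ideal.subset_span ⟨0, 0, rfl⟩)
      rw [← this, jK, hsm]
      simp only [map_add, map_sub, map_mul, map_pow, map_ofNat])
    (N := mk (9 * jP hU hs)) (by
      rw [hN]
      simp only [map_add, map_sub, map_mul, map_pow, map_ofNat])
  simp only [hX, hT, ← map_ofNat mk, ← map_mul, ← map_pow, ← map_add, ← map_sub] at key
  have hJ := eval_eq_zero hU hI hf hUx hUI (Ideal.Quotient.eq.1 key) w hw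
  have h9 : ∀ D : Derivation ℝ (Cyl (jetsOver U)) (Cyl (jetsOver U)), ∀ a, D (9 * a) = 9 * D a :=
    fun D a => by simp
  simp only [h9, Cyl.add_apply, Cyl.sub_apply, Cyl.mul_apply, Cyl.pow_apply, Cyl.ofNat_apply] at hJ
  rw [hsm, hsm3]
  simp only [Cyl.add_apply, Cyl.sub_apply, Cyl.mul_apply, Cyl.pow_apply, Cyl.ofNat_apply]
  have h5 : jF hI hf hUI 5 w = iteratedDeriv 5 f (w.1 (.inr (0, 0))) := rfl
  have h1 : jc U 0 1 w = w.1 (.inr (0, 1)) := rfl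
  rw [← h5, ← h1]
  linear_combination hJ / 9

end

/-! ### Quartic polynomials -/

theorem iteratedDeriv_eq_add {f : ℝ → ℝ} {I : Set ℝ} (hI : IsOpen I) (hIc : IsPreconnected I)
    (hf : ContDiffOn ℝ ∞ f I) {k : ℕ} {g g' : ℝ → ℝ} (hg : ∀ y, HasDerivAt g (g' y) y)
    (h : ∀ y ∈ I, iteratedDeriv (k + 1) f y = g' y) :
    ∃ a, ∀ y ∈ I, iteratedDeriv k f y = g y + a := by
  refine hI.exists_eq_add_of_deriv_eq hIc (fun y hy => ?_)
    (fun y _ => (hg y).differentiableAt.differentiableWithinAt) (fun y hy => ?_)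
  · exact ((contDiffAt_iteratedDeriv hI hf k hy).differentiableAt
      (by simp)).differentiableWithinAt
  · rw [← iteratedDeriv_succ, h y hy, (hg y).deriv]

theorem isQuarticOn_iff {f : ℝ → ℝ} {I : Set ℝ} (hI : IsOpen I) (hIc : IsPreconnected I)
    (hf : ContDiffOn ℝ ∞ f I) : IsQuarticOn f I ↔ ∀ y ∈ I, iteratedDeriv 5 f y = 0 := by
  constructor
  · rintro ⟨a, b, c, d, e, h⟩ y hy
    let p : Polynomial ℝ := .C a * .X ^ 4 + .C b * .X ^ 3 + .C c * .X ^ 2 + .C d * .X + .C e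
    have hp : f =ᶠ[nhds y] fun y => p.eval y := by
      filter_upwards [hI.mem_nhds hy] with y hy
      simp [p, h y hy]
    have hd : ∀ n, iteratedDeriv n (fun y => p.eval y) =
        fun y => (Polynomial.derivative^[n] p).eval y := fun n => by
      induction n with
      | zero => simp
      | succ n ih =>
        rw [iteratedDeriv_succ, ih, Function.iterate_succ_apply']
        exact funext fun y => Polynomial.deriv _
    have hn : p.natDegree ≤ 4 := by
      simp only [p]
      compute_degree
    rw [hp.iteratedDeriv_eq, hd, Polynomial.iterate_derivative_eq_zero (Nat.lt_succ_of_le hn)]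
    exact Polynomial.eval_zero
  · intro h
    -- Five successive integrations on the interval, each contributing one constant.
    obtain ⟨a, h⟩ := iteratedDeriv_eq_add (k := 4) hI hIc hf (fun y => hasDerivAt_const y (0 : ℝ)) h
    obtain ⟨b, h⟩ := iteratedDeriv_eq_add (k := 3) hI hIc hf (g := fun y => a * y)
      (fun y => by simpa using (hasDerivAt_id y).const_mul a) (by simpa using h)
    obtain ⟨c, h⟩ := iteratedDeriv_eq_add (k := 2) hI hIc hf (g := fun y => a / 2 * y ^ 2 + b * y)
      (g' := fun y => a * y + b) (fun y => by
        refine (((hasDerivAt_pow 2 y).const_mul (a / 2)).add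
          ((hasDerivAt_id' y).const_mul b)).congr_deriv ?_
        simp; ring) h
    obtain ⟨d, h⟩ := iteratedDeriv_eq_add (k := 1) hI hIc hf
      (g := fun y => a / 6 * y ^ 3 + b / 2 * y ^ 2 + c * y)
      (g' := fun y => a / 2 * y ^ 2 + b * y + c) (fun y => by
        refine ((((hasDerivAt_pow 3 y).const_mul (a / 6)).add
          ((hasDerivAt_pow 2 y).const_mul (b / 2))).add
          ((hasDerivAt_id' y).const_mul c)).congr_deriv ?_
        simp; ring) h
    obtain ⟨e, h⟩ := iteratedDeriv_eq_add (k := 0) hI hIc hf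
      (g := fun y => a / 24 * y ^ 4 + b / 6 * y ^ 3 + c / 2 * y ^ 2 + d * y)
      (g' := fun y => a / 6 * y ^ 3 + b / 2 * y ^ 2 + c * y + d) (fun y => by
        refine (((((hasDerivAt_pow 4 y).const_mul (a / 24)).add
          ((hasDerivAt_pow 3 y).const_mul (b / 6))).add
          ((hasDerivAt_pow 2 y).const_mul (c / 2))).add
          ((hasDerivAt_id' y).const_mul d)).congr_deriv ?_
        simp; ring) h
    exact ⟨_, _, _, _, _, fun y hy => by simpa using h y hy⟩

/-! ### Dependence on the variables of higher order -/

/-- The derivative sees only small `s`, for which the shifted point stays in `U`; being affine there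
with slope `r` suffices. -/
theorem fderiv_single_eq {P : (Fin 9 → ℝ) → ℝ} {U : Set (Fin 9 → ℝ)} (hU : IsOpen U)
    (hP : ContDiffOn ℝ ∞ P U) {z : Fin 9 → ℝ} (hz : z ∈ U) {i : Fin 9} {r : ℝ}
    (h : ∀ s : ℝ, z + s • Pi.single i 1 ∈ U → P (z + s • Pi.single i 1) = P z + s * r) :
    fderiv ℝ P z (Pi.single i 1) = r := by
  have hd : DifferentiableAt ℝ P z := (hP.contDiffAt (hU.mem_nhds hz)).differentiableAt (by simp)
  rw [← hd.lineDeriv_eq_fderiv, lineDeriv]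
  have hc : Filter.Tendsto (fun s : ℝ => z + s • Pi.single i (1 : ℝ)) (nhds 0) (nhds z) := by
    have : Continuous fun s : ℝ => z + s • (Pi.single i (1 : ℝ) : Fin 9 → ℝ) := by fun_prop
    simpa using this.tendsto 0
  have he : (fun s : ℝ => P (z + s • Pi.single i 1)) =ᶠ[nhds 0] fun s => P z + s * r := by
    filter_upwards [hc (hU.mem_nhds hz)] with s hs using h s hs
  rw [he.deriv_eq]
  simp

theorem knChar_add_single (f : ℝ → ℝ) (z : Fin 9 → ℝ) (s : ℝ) :
    knChar f (z + s • Pi.single 8 1) = knChar f z + s := by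
  have h : ∀ i : Fin 9, i ≠ 8 → (z + s • (Pi.single 8 1 : Fin 9 → ℝ)) i = z i := fun i hi => by
    simp [hi]
  have h8 : (z + s • (Pi.single 8 1 : Fin 9 → ℝ)) 8 = z 8 + s := by simp
  simp only [knChar, h8, h 2 (by decide), h 3 (by decide), h 4 (by decide), h 5 (by decide),
    h 6 (by decide)]
  ring

/-- The variable `u_txx` enters `knChar` only as a summand with coefficient one, so the derivative
of `P` in it is `c`. -/
theorem hasOrderAtLeastTwo_of_eq {f : ℝ → ℝ} {U : Set (Fin 9 → ℝ)} (hU : IsOpen U)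
    (hne : U.Nonempty) {P : (Fin 9 → ℝ) → ℝ} (hP : ContDiffOn ℝ ∞ P U) {c : ℝ} (hc : c ≠ 0)
    {R : (Fin 9 → ℝ) → ℝ} (hPR : ∀ z ∈ U, P z = c * knChar f z + R z)
    (hR : ∀ (z : Fin 9 → ℝ) (s : ℝ), z ∈ U → z + s • (Pi.single 8 1 : Fin 9 → ℝ) ∈ U → R (z + s • Pi.single 8 1) = R z) :
    HasOrderAtLeastTwo U P := by
  obtain ⟨z, hz⟩ := hne
  refine ⟨z, hz, 8, by decide, ?_⟩
  rw [fderiv_single_eq hU hP hz (r := c)]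
  · exact hc
  · intro s hs
    rw [hPR _ hs, hPR _ hz, hR z s hz hs, knChar_add_single]
    ring

/-! ### Classification of the symmetry characteristics -/

section

variable {U : Set (Fin 9 → ℝ)} (hU : IsOpen U) {f : ℝ → ℝ} {I : Set ℝ} (hI : IsOpen I)
  (hf : ContDiffOn ℝ ∞ f I) (hUx : ∀ z ∈ U, z 4 ≠ 0) (hUI : ∀ z ∈ U, z 2 ∈ I)

include hU hI hf hUx hUI

/-- Linearity of the determining equation. It is used both to split off the point symmetry and to
add it back. -/
theorem IsSymmChar.combination {P Q R : (Fin 9 → ℝ) → ℝ} (hP : IsSymmChar f U P)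
    (hR : IsSymmChar f U R) {c : ℝ} (h : ∀ z ∈ U, Q z = c * P z + R z) : IsSymmChar f U Q := by
  refine ⟨((contDiffOn_const.mul hP.1).add hR.1).congr h, fun q hq hs => ?_⟩
  obtain ⟨w, rfl⟩ := exists_toJet q
  have hQ : Rep (U := U) (fun q => Q (mixed q)) (c • jP hU hP.1 + jP hU hR.1) := fun w => by
    rw [Cyl.add_apply, Cyl.smul_apply, jP_apply, jP_apply]
    exact h _ w.2
  have h1 := hP.2 _ hq hs
  have h2 := hR.2 _ hq hs
  rw [rep_symmDet hU hI hf hUx hUI (rep_jP hU hP.1) ⟨w, hq⟩] at h1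
  rw [rep_symmDet hU hI hf hUx hUI (rep_jP hU hR.1) ⟨w, hq⟩] at h2
  rw [rep_symmDet hU hI hf hUx hUI hQ ⟨w, hq⟩]
  simp only [map_add, (JX hU).map_smul, (JT hU).map_smul, Cyl.add_apply, Cyl.sub_apply, Cyl.mul_apply, Cyl.smul_apply]
    at h1 h2 ⊢
  linear_combination c * h1 + h2

theorem isSymmChar_knChar (h : ∀ z ∈ U, iteratedDeriv 5 f (z 2) = 0) :
    IsSymmChar f U (knChar f) := by
  refine ⟨contDiffOn_knChar hI hf hUx hUI, fun q hq hs => ?_⟩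
  obtain ⟨w, rfl⟩ := exists_toJet q
  rw [symmDet_knChar hU hI hf hUx hUI ⟨w, hq⟩ hs,
    show iteratedDeriv 5 f (w (.inr (0, 0))) = 0 from h _ hq]
  ring

/-- The form of all symmetry characteristics. -/
theorem IsSymmChar.exists_form (hUc : IsPreconnected U) {P : (Fin 9 → ℝ) → ℝ}
    (hP : IsSymmChar f U P) : ∃ δ a₂ a₁ a₀ μ ν ρ : ℝ,
      (∀ z ∈ U, δ * iteratedDeriv 5 f (z 2) = 0) ∧
      ∀ z ∈ U, P z = δ * knChar f z + (a₂ * z 2 ^ 2 + a₁ * z 2 + a₀ - (μ * z 0 + ν) * z 3 -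
        (1 / 3 * μ * z 1 + ρ) * z 4) := by
  obtain ⟨S, hS, hE, hPS⟩ := frame_solution hU hI hf hUx hUI hP
  obtain ⟨δ, a₂, a₁, a₀, μ, ν, ρ, lδ, l2, l1, l0, lμ, lν, lρ, hδ, hS⟩ :=
    Frame.solution_const hS hE
  have hc : ∀ F : Cyl (dom hU hI hf hUx hUI).O, (Domain.frame _).Lvl 0 F → ∃ r : ℝ, ∀ v, F v = r := fun F hF =>
    Cyl.exists_eq_const (dom hU hI hf hUx hUI).hO (domainOver_preconnected hI hf hU hUx hUI hUc) F
      fun i => hF i (Nat.zero_le _)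
  obtain ⟨δ', eδ⟩ := hc _ lδ
  obtain ⟨a₂', e2⟩ := hc _ l2
  obtain ⟨a₁', e1⟩ := hc _ l1
  obtain ⟨a₀', e0⟩ := hc _ l0
  obtain ⟨μ', eμ⟩ := hc _ lμ
  obtain ⟨ν', eν⟩ := hc _ lν
  obtain ⟨ρ', eρ⟩ := hc _ lρ
  -- One point over each `z` is enough, so the free higher coordinates are set to zero.
  have hv : ∀ z ∈ U, zinv f z 0 ∈ (dom hU hI hf hUx hUI).O := fun z hz => by
    change zpt f (zinv f z 0) ∈ U
    rwa [zpt_zinv f z (hUx z hz)]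
  -- The formula for `18S` is multiplied by `p/18`, with `pσ = (9/2) P̃₀` and `pω₀ = u_t/2`. The
  -- signs are those of the shape `η - τu_t - ξu_x`; the factor `1/3` between the `x` and `t`
  -- scalings reflects `2β_x = γ_t`.
  refine ⟨δ' / 2, a₂' / 18, a₁' / 9, a₀' / 18, -μ' / 3, -ρ' / 6, -ν' / 9, fun z hz => ?_,
    fun z hz => ?_⟩
  · have h := congrArg (fun a : Cyl (dom hU hI hf hUx hUI).O => a ⟨_, hv z hz⟩) hδ
    simp only [Cyl.mul_apply, eδ, Cyl.zero_apply] at h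
    have hF : (dom hU hI hf hUx hUI).frame.F 5 ⟨_, hv z hz⟩ = iteratedDeriv 5 f (z 2) / 2 := rfl
    rw [hF] at h
    linear_combination h
  · have h := congrArg (fun a : Cyl (dom hU hI hf hUx hUI).O => a ⟨_, hv z hz⟩) hS
    have hp := hPS ⟨_, hv z hz⟩
    have hz4 := hUx z hz
    rw [show zpt f (zinv f z 0) = z from zpt_zinv f z hz4 0] at hp
    have hF0 : (dom hU hI hf hUx hUI).frame.F 0 ⟨_, hv z hz⟩ = f (z 2) / 2 := by
      change iteratedDeriv 0 f (z 2) / 2 = _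
      rw [iteratedDeriv_zero]
    have hF1 : (dom hU hI hf hUx hUI).frame.F 1 ⟨_, hv z hz⟩ = deriv f (z 2) / 2 := by
      change iteratedDeriv 1 f (z 2) / 2 = _
      rw [iteratedDeriv_one]
    have hF2 : (dom hU hI hf hUx hUI).frame.F 2 ⟨_, hv z hz⟩ = deriv (deriv f) (z 2) / 2 := by
      change iteratedDeriv 2 f (z 2) / 2 = _
      rw [iteratedDeriv_succ, iteratedDeriv_one]
    have hq : (dom hU hI hf hUx hUI).frame.q ⟨_, hv z hz⟩ = (z 4)⁻¹ := rfl
    have hw : ∀ i, (dom hU hI hf hUx hUI).frame.v i ⟨_, hv z hz⟩ = zinv f z 0 i := fun i => rfl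
    have h3 : zinv f z 0 3 = z 4 := rfl
    simp only [Frame.sigma, Frame.chi, Frame.psi, Cyl.mul_apply, Cyl.add_apply, Cyl.sub_apply,
      Cyl.pow_apply, Cyl.ofNat_apply, eδ, e2, e1, e0, eμ, eν, eρ, hF0, hF1, hF2, hq, hw] at h
    replace hp : P z = z 4 * S ⟨_, hv z hz⟩ := hp
    generalize S ⟨_, hv z hz⟩ = s at h hp
    simp only [zinv, zinvPoly] at h
    have hs : P z = z 4 * (18 * s) / 18 := by rw [hp]; ring
    rw [hs, h]
    simp only [knChar]
    field_simp
    ring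

/-- A symmetry characteristic is a multiple of the explicit one up to point symmetries. -/
theorem IsSymmChar.exists_eq_add (hUc : IsPreconnected U) {P : (Fin 9 → ℝ) → ℝ}
    (hP : IsSymmChar f U P) (hP2 : HasOrderAtLeastTwo U P) :
    (∀ z ∈ U, iteratedDeriv 5 f (z 2) = 0) ∧
      ∃ c : ℝ, c ≠ 0 ∧ ∃ R, IsPointSymmChar f U R ∧ ∀ z ∈ U, P z = c * knChar f z + R z := by
  obtain ⟨δ, a₂, a₁, a₀, μ, ν, ρ, h5, hPf⟩ := hP.exists_form hU hI hf hUx hUI hUc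
  -- With `δ = 0` only the first five variables would occur, contradicting order at least two.
  have hδ : δ ≠ 0 := by
    rintro rfl
    obtain ⟨z, hz, i, hi, hd⟩ := hP2
    refine hd (fderiv_single_eq hU hP.1 hz fun s hs => ?_)
    have h : ∀ j : Fin 9, j < 5 → (z + s • (Pi.single i 1 : Fin 9 → ℝ)) j = z j := fun j hj => by
      simp [(hj.trans_le hi).ne]
    rw [hPf _ hs, hPf _ hz, h 0 (by decide), h 1 (by decide), h 2 (by decide), h 3 (by decide),
      h 4 (by decide)]
    ring
  have h5' : ∀ z ∈ U, iteratedDeriv 5 f (z 2) = 0 := fun z hz =>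
    (mul_eq_zero.1 (h5 z hz)).resolve_left hδ
  -- The remainder is a symmetry because `δ ≠ 0` has already forced `f⁽⁵⁾ = 0`, which makes `knChar
  -- f` a characteristic.
  refine ⟨h5', δ, hδ, fun z => -δ * knChar f z + P z, ⟨?_, fun x => a₂ * x.2.2 ^ 2 + a₁ * x.2.2 + a₀,
    fun x => μ * x.1 + ν, fun x => 1 / 3 * μ * x.2.1 + ρ, ?_, ?_, ?_, fun z hz => ?_⟩,
    fun z hz => by ring⟩
  · have hkn := isSymmChar_knChar hU hI hf hUx hUI h5'
    exact hkn.combination hU hI hf hUx hUI hP fun z _ => rfl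
  · exact ContDiff.contDiffOn (by fun_prop)
  · exact ContDiff.contDiffOn (by fun_prop)
  · exact ContDiff.contDiffOn (by fun_prop)
  · simp only [hPf z hz, txu]
    ring

end

end GKN

end

/-! ### The main theorem -/

theorem mainTheorem2 (I : Set ℝ) (hIo : IsOpen I) (hIc : IsPreconnected I)
    (f : ℝ → ℝ) (hf : ContDiffOn ℝ ∞ f I) (hf0 : ∃ y ∈ I, f y ≠ 0)
    (U : Set (Fin 9 → ℝ)) (hUo : IsOpen U) (hUc : IsConnected U)
    (hUx : ∀ z ∈ U, z 4 ≠ 0) (hUI : (fun z : Fin 9 → ℝ => z 2) '' U = I) :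
    ((∃ P : (Fin 9 → ℝ) → ℝ, GKN.IsHigherOrderSymmChar f U P) ↔ GKN.IsQuarticOn f I) ∧
    (GKN.IsQuarticOn f I →
      GKN.IsHigherOrderSymmChar f U (GKN.knChar f) ∧
      ∀ P : (Fin 9 → ℝ) → ℝ, GKN.IsHigherOrderSymmChar f U P ↔
        ∃ c : ℝ, c ≠ 0 ∧ ∃ R : (Fin 9 → ℝ) → ℝ, GKN.IsPointSymmChar f U R ∧
          ∀ z ∈ U, P z = c * GKN.knChar f z + R z) := by
  have hUI' : ∀ z ∈ U, z 2 ∈ I := fun z hz => hUI ▸ Set.mem_image_of_mem _ hz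
  have hform : ∀ P, GKN.IsHigherOrderSymmChar f U P → _ := fun P hP =>
    hP.1.exists_eq_add hUo hIo hf hUx hUI' hUc.isPreconnected hP.2
  have hkn : GKN.IsQuarticOn f I → GKN.IsHigherOrderSymmChar f U (GKN.knChar f) := fun hq => by
    have hs := GKN.isSymmChar_knChar hUo hIo hf hUx hUI' fun z hz =>
      (GKN.isQuarticOn_iff hIo hIc hf).1 hq _ (hUI' z hz)
    exact ⟨hs, GKN.hasOrderAtLeastTwo_of_eq hUo hUc.nonempty hs.1 one_ne_zero
      (R := fun _ => 0) (fun z _ => by ring) fun _ _ _ _ => rfl⟩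
  refine ⟨⟨fun ⟨P, hP⟩ => (GKN.isQuarticOn_iff hIo hIc hf).2 fun y hy => ?_,
    fun hq => ⟨_, hkn hq⟩⟩, fun hq => ⟨hkn hq, fun P => ⟨fun hP => (hform P hP).2, ?_⟩⟩⟩
  -- Surjectivity of the projection `U → I` carries the vanishing of `f⁽⁵⁾` from `U` to all of `I`.
  · obtain ⟨z, hz, rfl⟩ := hUI.symm ▸ hy
    exact (hform P hP).1 z hz
  · rintro ⟨c, hc, R, ⟨hR, η, τ, ξ, -, -, -, hRf⟩, hP⟩
    have hs := (hkn hq).1.combination hUo hIo hf hUx hUI' hR hP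
    refine ⟨hs, GKN.hasOrderAtLeastTwo_of_eq hUo hUc.nonempty hs.1 hc hP fun z s hz hs => ?_⟩
    have h : ∀ i : Fin 9, i ≠ 8 → (z + s • (Pi.single 8 1 : Fin 9 → ℝ)) i = z i := fun i hi => by
      simp [hi]
    rw [hRf _ hs, hRf _ hz]
    simp only [GKN.txu, h 0 (by decide), h 1 (by decide), h 2 (by decide), h 3 (by decide),
      h 4 (by decide)]
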